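/- **Equivalence of norms in $\Sigma_T$ and $\Sigma_h$.** *Mesh.* Let $\Omega\subset\mathbb R^2$ be an open, bounded, connected, contractible polygonal set of unit diameter. A polygonal mesh $\mathcal M_h$ of $\Omega$ consists of: a finite set $\mathcal T_h$ of disjoint, open, connected, contractible polygonal elements $T$ (interiors of finite unions of triangles) with $\overline\Omega=\bigcup_T\overline T$, each with a point $x_T$; a finite set $\mathcal E_h$ of disjoint open segments (edges) $E$, each contained either in $\partial T_1\cap\partial T_2$ for two distinct elements or in $\partial T\cap\partial\Omega$ for one element, with $\bigcup_T\partial T=\bigcup_E\overline E$; and the set $\mathcal V_h$ of the edge endpoints. Let $\mathcal E_T=\{E\in\mathcal E_h: E\subset\partial T\}$, let $\mathcal V_T$ be the set of endpoints of the edges in $\mathcal E_T$, and let $h_T$ be the diameter of $T$. Each edge has a fixed unit tangent $t_E$; $n_E$ is the unit normal such that $(t_E,n_E)$ is right-handed; $\omega_{TE}\in\{-1,1\}$ is such that $\omega_{TE}n_E$ points out of $T$. The mesh is *regular with parameter* $\rho>0$ if (a) there is a conforming triangulation of $\overline\Omega$ such that each open triangle $\tau$ lies in exactly one element, each open side of a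 triangle is either disjoint from or contained in any given mesh edge, and $\rho h_\tau\le r_\tau$ ($h_\tau$ the diameter and $r_\tau$ the inradius of $\tau$), and $\rho h_T\le h_\tau$ whenever $\tau\subset T$; and (b) each $T$ contains the disk of centre $x_T$ and radius $\rho h_T$. *Spaces.* For an element or edge $Y$, $\mathcal P^m(Y)$ is the space of restrictions to $Y$ of bivariate polynomials of total degree $\le m$ ($\mathcal P^{-1}(Y)=\{0\}$). Put $\mathbf{rot}\,q=(\partial_2q,-\partial_1q)$, $\mathcal R^m(T)=\mathbf{rot}\,\mathcal P^{m+1}(T)$ and $\mathcal R^{c,m}(T)=(x-x_T)\mathcal P^{m-1}(T)$. For an integer $k\ge0$, $\Sigma_h$ is the space of families $$v_h=\big((v_{\mathcal R,T},v^c_{\mathcal R,T})_{T\in\mathcal T_h},(v_E,C_{v,E})_{E\in\mathcal E_h},(C_{v,\nu})_{\nu\in\mathcal V_h}\big)$$ with $v_{\mathcal R,T}\in\mathcal R^{k-1}(T)$, $v^c_{\mathcal R,T}\in\mathcal R^{c,k}(T)$, $v_E\in\mathcal P^k(E)$, $C_{v,E}\in\mathcal P^{k-1}(E)$, $C_{v,\nu}\in\mathbb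 R$; $\Sigma_T$ is the space of the families of components on $T$, $\mathcal E_T$ and $\mathcal V_T$, and $v_T\in\Sigma_T$ is the restriction of $v_h$. *Reconstructions.* For $v_T\in\Sigma_T$, $R_Tv_T\in\mathcal P^k(T)$ is defined by $$\int_T R_Tv_T\,q=\int_T v_{\mathcal R,T}\cdot\mathbf{rot}\,q-\sum_{E\in\mathcal E_T}\omega_{TE}\int_E v_E\,q\qquad\forall q\in\mathcal P^k(T),$$ and $P_Tv_T\in\mathcal P^k(T)^2$ is defined by $$\int_T P_Tv_T\cdot(\mathbf{rot}\,q+w)=\int_T R_Tv_T\,q+\sum_{E\in\mathcal E_T}\omega_{TE}\int_E v_E\,q+\int_T v^c_{\mathcal R,T}\cdot w$$ for all $q\in\mathcal P^{k+1}(T)$ with $\int_Tq=0$ and all $w\in\mathcal R^{c,k}(T)$. Let $\pi_E^{k-1}$ be the $L^2$-orthogonal projector on $\mathcal P^{k-1}(E)$. *Norms.* The component norm is given by $$|||v_T|||_{\Sigma,T}^2=\|v_{\mathcal R,T}\|_{L^2(T)}^2+\|v^c_{\mathcal R,T}\|_{L^2(T)}^2+h_T\sum_{E\in\mathcal E_T}\|v_E\|_{L^2(E)}^2+h_T^3\sum_{E\in\mathcal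 E_T}\|C_{v,E}\|_{L^2(E)}^2+h_T^4\sum_{\nu\in\mathcal V_T}|C_{v,\nu}|^2,$$ $|||v_h|||_{\Sigma,h}^2=\sum_{T}|||v_T|||_{\Sigma,T}^2$. The discrete $L^2$-product is $$\begin{aligned}(w_T,v_T)_{\Sigma,T}={}&\int_T P_Tw_T\cdot P_Tv_T+h_T\sum_{E\in\mathcal E_T}\int_E(P_Tw_T\cdot t_E-w_E)(P_Tv_T\cdot t_E-v_E)\\&+h_T^3\sum_{E\in\mathcal E_T}\int_E\pi_E^{k-1}(R_Tw_T-C_{w,E})\,\pi_E^{k-1}(R_Tv_T-C_{v,E})\\&+h_T^4\sum_{\nu\in\mathcal V_T}(R_Tw_T(\nu)-C_{w,\nu})(R_Tv_T(\nu)-C_{v,\nu}),\end{aligned}$$ $(w_h,v_h)_{\Sigma,h}=\sum_T(w_T,v_T)_{\Sigma,T}$, and $\|\cdot\|_{\Sigma,\bullet}=(\cdot,\cdot)_{\Sigma,\bullet}^{1/2}$ for $\bullet=T$ or $\bullet=h$. *Statement.* For all $\Omega$, $\rho>0$ and $k\ge0$ there is a constant $C>0$, depending only on $\Omega$, $\rho$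 and $k$, such that for every polygonal mesh $\mathcal M_h$ of $\Omega$ that is regular with parameter $\rho$ and for every $\bullet\in\mathcal T_h\cup\{h\}$, $$|||v_\bullet|||_{\Sigma,\bullet}\le C\,\|v_\bullet\|_{\Sigma,\bullet}\quad\text{and}\quad\|v_\bullet\|_{\Sigma,\bullet}\le C\,|||v_\bullet|||_{\Sigma,\bullet}\qquad\forall v_\bullet\in\Sigma_\bullet.$$ -/

import Mathlib

noncomputable section

namespace RotRot

open MeasureTheory Polynomial

/-- The Euclidean plane. -/
abbrev Plane := EuclideanSpace ℝ (Fin 2)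

/-! ### Polygonal sets and polygonal meshes -/

/-- A polygonal set: a connected (in particular nonempty) set which is the interior of a finite
union of closed nondegenerate triangles. -/
def IsPolygonal (A : Set Plane) : Prop :=
  IsConnected A ∧ ∃ F : Finset (Fin 3 → Plane), (∀ p ∈ F, AffineIndependent ℝ p) ∧
    A = interior (⋃ p ∈ F, convexHull ℝ (Set.range p))

/-- A nondegenerate segment, oriented from `src` to `tgt`. -/
structure Edge where
  src : Plane
  tgt : Plane
  ne : src ≠ tgt

namespace Edge

/-- The edge as a point set: the open segment between its endpoints. -/
def carrier (E : Edge) : Set Plane := openSegment ℝ E.src E.tgt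

/-- The length `|E|` of the edge. -/
def length (E : Edge) : ℝ := dist E.src E.tgt

/-- The unit tangent vector `t_E`. -/
def tangent (E : Edge) : Plane := E.length⁻¹ • (E.tgt - E.src)

/-- The unit normal vector `n_E`, such that `(t_E, n_E)` is right-handed. -/
def normal (E : Edge) : Plane := !₂[-(E.tangent 1), E.tangent 0]

open Classical in
/-- The vertices of the edge: its two endpoints. -/
def vertices (E : Edge) : Finset Plane := {E.src, E.tgt}

end Edge

/-- A polygonal mesh of `Ω`: a finite family of disjoint open polygonal elements `T`, each one
contractible and equipped with a point `x_T = center T`, and a finite family of disjoint open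
segments (each with a fixed orientation) that partition the mesh skeleton and are either
interfaces between two distinct elements or boundary edges. -/
structure PolygonalMesh (Ω : Set Plane) where
  elements : Finset (Set Plane)
  edges : Finset Edge
  center : Set Plane → Plane
  isPolygonal : ∀ T ∈ elements, IsPolygonal T
  contractible : ∀ T ∈ elements, ContractibleSpace T
  elements_disjoint : ∀ T₁ ∈ elements, ∀ T₂ ∈ elements, T₁ ≠ T₂ → Disjoint T₁ T₂
  closure_eq : closure Ω = ⋃ T ∈ elements, closure T
  edges_disjoint : ∀ E₁ ∈ edges, ∀ E₂ ∈ edges, E₁ ≠ E₂ → Disjoint E₁.carrier E₂.carrier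
  interface_or_boundary : ∀ E ∈ edges,
    (∃ T₁ ∈ elements, ∃ T₂ ∈ elements, T₁ ≠ T₂ ∧ E.carrier ⊆ frontier T₁ ∩ frontier T₂) ∨
    (∃ T ∈ elements, E.carrier ⊆ frontier T ∩ frontier Ω)
  skeleton_eq : ⋃ T ∈ elements, frontier T = ⋃ E ∈ edges, closure E.carrier

namespace PolygonalMesh

variable {Ω : Set Plane}

open Classical in
/-- The set of mesh vertices: the endpoints of the mesh edges. -/
def vertices (M : PolygonalMesh Ω) : Finset Plane := M.edges.biUnion Edge.vertices

open Classical in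
/-- The set of edges of the element `T`: the mesh edges contained in its boundary. -/
def edgesOf (M : PolygonalMesh Ω) (T : Set Plane) : Finset Edge :=
  M.edges.filter fun E => E.carrier ⊆ frontier T

open Classical in
/-- The set of vertices of the element `T`: the endpoints of its edges. -/
def verticesOf (M : PolygonalMesh Ω) (T : Set Plane) : Finset Plane :=
  (M.edgesOf T).biUnion Edge.vertices

theorem mem_edges_of_mem_edgesOf {M : PolygonalMesh Ω} {T : Set Plane} {E : Edge}
    (h : E ∈ M.edgesOf T) : E ∈ M.edges := by
  classical
  exact (Finset.mem_filter.1 h).1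

theorem mem_vertices_of_mem_verticesOf {M : PolygonalMesh Ω} {T : Set Plane} {x : Plane}
    (h : x ∈ M.verticesOf T) : x ∈ M.vertices := by
  classical
  obtain ⟨E, hE, hx⟩ := Finset.mem_biUnion.1 h
  exact Finset.mem_biUnion.2 ⟨E, mem_edges_of_mem_edgesOf hE, hx⟩

open Classical in
/-- `K` is a matching simplicial submesh of `M` (a conforming triangulation of the closure of `Ω`,
such that each open triangle lies in one and only one mesh element and each open triangle side
is either disjoint from or contained in any given mesh edge) which satisfies, with parameter `ρ`,
the shape regularity `ρ h_τ ≤ r_τ` (`r_τ` the inradius) and the contact regularity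
`ρ h_T ≤ h_τ` for every triangle `τ` contained in the element `T`. -/
structure IsRegularSubmesh (M : PolygonalMesh Ω) (ρ : ℝ)
    (K : Geometry.SimplicialComplex ℝ Plane) : Prop where
  finite : K.faces.Finite
  pure : ∀ s ∈ K.faces, ∃ t ∈ K.faces, s ⊆ t ∧ t.card = 3
  space_eq : K.space = closure Ω
  element : ∀ s ∈ K.faces, s.card = 3 →
    ∃! T, T ∈ M.elements ∧ interior (convexHull ℝ (s : Set Plane)) ⊆ T
  edge : ∀ a b : Plane, a ≠ b → ({a, b} : Finset Plane) ∈ K.faces → ∀ E ∈ M.edges,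
    Disjoint (openSegment ℝ a b) E.carrier ∨ openSegment ℝ a b ⊆ E.carrier
  shape : ∀ s ∈ K.faces, s.card = 3 → ∃ x,
    Metric.closedBall x (ρ * Metric.diam (convexHull ℝ (s : Set Plane))) ⊆
      convexHull ℝ (s : Set Plane)
  contact : ∀ s ∈ K.faces, s.card = 3 → ∀ T ∈ M.elements,
    interior (convexHull ℝ (s : Set Plane)) ⊆ T →
      ρ * Metric.diam T ≤ Metric.diam (convexHull ℝ (s : Set Plane))

/-- The mesh is regular with parameter `ρ`: it has a matching simplicial submesh that is shape and
contact regular, and each element `T` contains the disk of centre `x_T` and radius `ρ h_T`. -/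
def IsRegular (M : PolygonalMesh Ω) (ρ : ℝ) : Prop :=
  (∃ K, M.IsRegularSubmesh ρ K) ∧
    ∀ T ∈ M.elements, Metric.ball (M.center T) (ρ * Metric.diam T) ⊆ T

end PolygonalMesh

open Classical in
/-- The orientation `ω_{TE}` of the edge `E` relative to the element `T`, such that `ω_{TE} n_E`
points out of `T`: it is `1` if `T` lies on the side of `E` to which `-n_E` points (that is, if `T`
contains a half-disk on that side, centred at some point of `E`), and `-1` otherwise. -/
def orientation (T : Set Plane) (E : Edge) : ℝ :=
  if ∃ x ∈ E.carrier, ∃ ε > 0, ∀ y ∈ Metric.ball x ε, inner ℝ (y - x) E.normal < 0 → y ∈ T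
  then 1 else -1

/-! ### Polynomial spaces

Since elements are nonempty and open, polynomial functions on an element are identified with
bivariate polynomials; this also gives their traces on edges and their values at vertices. -/

/-- Bivariate polynomials. -/
abbrev Poly := MvPolynomial (Fin 2) ℝ

/-- Bivariate polynomial vector fields. -/
abbrev VecPoly := Fin 2 → Poly

/-- The space of bivariate polynomials of total degree `≤ m`; it is `{0}` for `m = -1`. -/
def polySpace (m : ℤ) : Submodule ℝ Poly :=
  MvPolynomial.restrictSupport ℝ {d : Fin 2 →₀ ℕ | (d.degree : ℤ) ≤ m}

/-- The polynomial vector fields with both components of total degree `≤ m`. -/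
def vecPolySpace (m : ℤ) : Submodule ℝ VecPoly :=
  Submodule.pi Set.univ fun _ => polySpace m

/-- The vector rotor `(∂₂ q, -∂₁ q)`. -/
def vrot : Poly →ₗ[ℝ] VecPoly where
  toFun q := ![MvPolynomial.pderiv 1 q, -MvPolynomial.pderiv 0 q]
  map_add' p q := by
    ext1 i; fin_cases i
    · simp
    · simp [add_comm]
  map_smul' c p := by
    ext1 i; fin_cases i <;> simp

/-- The map `q ↦ (x - x₀) q`. -/
def koszul (x₀ : Plane) : Poly →ₗ[ℝ] VecPoly where
  toFun q := fun i => (MvPolynomial.X i - MvPolynomial.C (x₀ i)) * q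
  map_add' p q := by ext1 i; simp [mul_add]
  map_smul' c p := by ext1 i; simp

/-- The space `R^m(T) = VROT P^{m+1}(T)`. -/
def rolySpace (m : ℤ) : Submodule ℝ VecPoly := (polySpace (m + 1)).map vrot

/-- The complement `R^{c,m}(T) = (x - x_T) P^{m-1}(T)`, with `x₀ = x_T`. -/
def crolySpace (m : ℤ) (x₀ : Plane) : Submodule ℝ VecPoly := (polySpace (m - 1)).map (koszul x₀)

/-- The value of a polynomial at a point. -/
def evalAt (x : Plane) (p : Poly) : ℝ := MvPolynomial.eval (fun i => x i) p

/-- The pointwise scalar product of two polynomial vector fields. -/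
def dot (v w : VecPoly) : Poly := v 0 * w 0 + v 1 * w 1

/-- The integral of a polynomial over an element. -/
def intElem (T : Set Plane) (p : Poly) : ℝ := ∫ x in T, evalAt x p

/-- The restriction of a bivariate polynomial to the edge `E`, written as a polynomial in the
coordinate `s ∈ (0,1)` along `E` that parametrises the point `src + s (tgt - src)`. -/
def traceEdge (E : Edge) : Poly →ₐ[ℝ] ℝ[X] :=
  MvPolynomial.aeval fun i =>
    Polynomial.C (E.src i) + Polynomial.C (E.tgt i - E.src i) * Polynomial.X

/-- The space `P^m(E)` of the restrictions to `E` of bivariate polynomials of degree `≤ m`. -/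
def edgePolySpace (E : Edge) (m : ℤ) : Submodule ℝ ℝ[X] :=
  (polySpace m).map (traceEdge E).toLinearMap

/-- The integral over `E`, with respect to arc length, of a function that is polynomial in the
normalised coordinate `s` along `E`. -/
def intEdge (E : Edge) (p : ℝ[X]) : ℝ := E.length * ∫ s in (0 : ℝ)..1, p.eval s

/-- The tangential component `v · t_E` of (the trace of) a vector field on `E`. -/
def tangentialTrace (E : Edge) (v : VecPoly) : ℝ[X] :=
  Polynomial.C (E.tangent 0) * traceEdge E (v 0) + Polynomial.C (E.tangent 1) * traceEdge E (v 1)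

/-- The `L²`-orthogonal projector on `P^m(E)`. -/
def edgeProj (E : Edge) (m : ℤ) (f : ℝ[X]) : ℝ[X] :=
  Classical.epsilon fun g => g ∈ edgePolySpace E m ∧
    ∀ r ∈ edgePolySpace E m, intEdge E (g * r) = intEdge E (f * r)

/-! ### The discrete rot-rot space -/

section Spaces

variable {Ω : Set Plane}

/-- The local space `Σ_T^k`. -/
structure SigmaT (M : PolygonalMesh Ω) (k : ℕ) (T : Set Plane) where
  /-- the component in `R^{k-1}(T)` -/
  vR : rolySpace ((k : ℤ) - 1)
  /-- the component in `R^{c,k}(T)` -/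
  vRc : crolySpace k (M.center T)
  /-- the components `v_E` in `P^k(E)` -/
  vE : ∀ E : M.edgesOf T, edgePolySpace E.1 k
  /-- the edge rotor components `C_{v,E}` in `P^{k-1}(E)` -/
  cE : ∀ E : M.edgesOf T, edgePolySpace E.1 ((k : ℤ) - 1)
  /-- the vertex rotor components `C_{v,ν}` -/
  cV : M.verticesOf T → ℝ

/-- The global space `Σ_h^k`. -/
structure SigmaH (M : PolygonalMesh Ω) (k : ℕ) where
  vR : ∀ _ : M.elements, rolySpace ((k : ℤ) - 1)
  vRc : ∀ T : M.elements, crolySpace k (M.center T.1)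
  vE : ∀ E : M.edges, edgePolySpace E.1 k
  cE : ∀ E : M.edges, edgePolySpace E.1 ((k : ℤ) - 1)
  cV : M.vertices → ℝ

/-- The restriction of a global vector to an element: its components on `T` and its boundary. -/
def SigmaH.restrict {M : PolygonalMesh Ω} {k : ℕ} (v : SigmaH M k) (T : M.elements) :
    SigmaT M k T.1 where
  vR := v.vR T
  vRc := v.vRc T
  vE E := v.vE ⟨E.1, PolygonalMesh.mem_edges_of_mem_edgesOf E.2⟩
  cE E := v.cE ⟨E.1, PolygonalMesh.mem_edges_of_mem_edgesOf E.2⟩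
  cV x := v.cV ⟨x.1, PolygonalMesh.mem_vertices_of_mem_verticesOf x.2⟩

namespace SigmaT

variable {M : PolygonalMesh Ω} {k : ℕ} {T : Set Plane}

/-- The element scalar rotor `R_T^k v`: the unique `R ∈ P^k(T)` such that, for all `q ∈ P^k(T)`,
`∫_T R q = ∫_T v_R · VROT q - ∑_E ω_{TE} ∫_E v_E q`. -/
def rotor (v : SigmaT M k T) : Poly :=
  Classical.epsilon fun R => R ∈ polySpace k ∧ ∀ q ∈ polySpace k,
    intElem T (R * q) = intElem T (dot (v.vR : VecPoly) (vrot q))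
      - ∑ E : M.edgesOf T, orientation T E.1 * intEdge E.1 ((v.vE E : ℝ[X]) * traceEdge E.1 q)

/-- The vector potential `P_{Σ,T}^k v`: the unique `P ∈ P^k(T; ℝ²)` such that, for all
`q ∈ P^{k+1}(T)` with zero mean value over `T` and all `w ∈ R^{c,k}(T)`,
`∫_T P · (VROT q + w) = ∫_T (R_T^k v) q + ∑_E ω_{TE} ∫_E v_E q + ∫_T v_R^c · w`. -/
def potential (v : SigmaT M k T) : VecPoly :=
  Classical.epsilon fun P => P ∈ vecPolySpace k ∧
    ∀ q ∈ polySpace ((k : ℤ) + 1), intElem T q = 0 → ∀ w ∈ crolySpace k (M.center T),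
      intElem T (dot P (vrot q + w)) = intElem T (v.rotor * q)
        + ∑ E : M.edgesOf T, orientation T E.1 * intEdge E.1 ((v.vE E : ℝ[X]) * traceEdge E.1 q)
        + intElem T (dot (v.vRc : VecPoly) w)

/-- The square of the component norm `|||·|||_{rot,T}` of the rot components of `v`. -/
def tnormRotSq (v : SigmaT M k T) : ℝ :=
  intElem T (dot (v.vR : VecPoly) v.vR) + intElem T (dot (v.vRc : VecPoly) v.vRc)
    + Metric.diam T * ∑ E : M.edgesOf T, intEdge E.1 ((v.vE E : ℝ[X]) ^ 2)

/-- The square of the component norm `|||v|||_{Σ,T}`. -/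
def tnormSq (v : SigmaT M k T) : ℝ :=
  v.tnormRotSq
    + Metric.diam T ^ 3 * ∑ E : M.edgesOf T, intEdge E.1 ((v.cE E : ℝ[X]) ^ 2)
    + Metric.diam T ^ 4 * ∑ x : M.verticesOf T, |v.cV x| ^ 2

/-- The component norm `|||v|||_{Σ,T}`. -/
def tnorm (v : SigmaT M k T) : ℝ := √v.tnormSq

/-- The local discrete `L²`-product `(w, v)_{Σ,T}`. -/
def l2prod (w v : SigmaT M k T) : ℝ :=
  intElem T (dot w.potential v.potential)
    + Metric.diam T * ∑ E : M.edgesOf T, intEdge E.1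
        ((tangentialTrace E.1 w.potential - w.vE E) * (tangentialTrace E.1 v.potential - v.vE E))
    + Metric.diam T ^ 3 * ∑ E : M.edgesOf T, intEdge E.1
        (edgeProj E.1 ((k : ℤ) - 1) (traceEdge E.1 w.rotor - w.cE E)
          * edgeProj E.1 ((k : ℤ) - 1) (traceEdge E.1 v.rotor - v.cE E))
    + Metric.diam T ^ 4 * ∑ x : M.verticesOf T,
        (evalAt x.1 w.rotor - w.cV x) * (evalAt x.1 v.rotor - v.cV x)

/-- The norm `‖v‖_{Σ,T}` induced by the local discrete `L²`-product. -/
def opNorm (v : SigmaT M k T) : ℝ := √(l2prod v v)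

end SigmaT

namespace SigmaH

variable {M : PolygonalMesh Ω} {k : ℕ}

/-- The global component norm `|||v|||_{Σ,h}`. -/
def tnorm (v : SigmaH M k) : ℝ := √(∑ T : M.elements, (v.restrict T).tnorm ^ 2)

/-- The global discrete `L²`-product `(w, v)_{Σ,h}`. -/
def l2prod (w v : SigmaH M k) : ℝ :=
  ∑ T : M.elements, SigmaT.l2prod (w.restrict T) (v.restrict T)

/-- The norm `‖v‖_{Σ,h}` induced by the global discrete `L²`-product. -/
def opNorm (v : SigmaH M k) : ℝ := √(l2prod v v)

end SigmaH

end Spaces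

end RotRot

end

namespace RotRot

/-! ### Bilinear forms -/

section Forms

variable {V : Type*} [AddCommGroup V] [Module ℝ V]

/-! The two norms are compared on each element through the reconstructions. Write h for h_T, R for
`rotor`, P for `potential`, and X for `tnormRotSq`, the part of the squared component norm carried
by `vR`, `vRc` and `vE`.

The element components can be read off from P. Testing P with w = v^c gives ∫ P·v^c = ‖v^c‖².
Testing with a mean-free q such that rot q = v_R, and inserting the definition of R, makes the
boundary terms cancel and gives ∫ P·v_R = ‖v_R‖². By Cauchy–Schwarz both components are bounded by
‖P‖ (`intElem_components_le`).

Conversely, h²‖R‖² and ‖P‖² are bounded by X (`exists_reconstruction_le`). For R, the test function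
is R itself, and the inverse inequality for the rotor and the discrete trace inequality absorb one
factor ‖R‖. For P, one writes P = rot q + w with ‖q‖ ≲ h‖P‖ and ‖w‖ ≲ ‖P‖
(`exists_stable_decomposition`) and uses (q, w) as test pair.

The remaining components `vE`, `cE`, `cV` differ from traces or values of P and R by the
stabilisation terms of the discrete product, so the triangle inequality and the trace bounds
exchange them. The projector in the `cE` term is harmless because `cE` lies in its range.

Uniformity in the mesh has two sources. Each element lies between the disks of radii ρh and h about
x_T, so x ↦ x_T + h x reduces every polynomial estimate to equivalence of quadratic forms on a
finite-dimensional space over one reference disk (`exists_form_le`, `exists_evalAt_sq_le_intElem`).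
The number of edges of an element is bounded by comparing the areas of the submesh triangles with
that of the large disk (`card_edgesOf_mul_le`). The orientation signs enter the estimates only
through their square being 1. Summing the squared local estimates gives the global one. -/

theorem form_sq_le {B : V →ₗ[ℝ] V →ₗ[ℝ] ℝ} (hB : ∀ v, 0 ≤ B v v) (hs : ∀ v w, B v w = B w v)
    (v w : V) : B v w ^ 2 ≤ B v v * B w w := by
  have h := LinearMap.BilinForm.apply_mul_apply_le_of_forall_zero_le B hB v w
  rw [hs w v] at h
  nlinarith

/-- Riesz representation in a finite-dimensional subspace on which the form is definite. -/
theorem exists_represent (B : V →ₗ[ℝ] V →ₗ[ℝ] ℝ) (W : Submodule ℝ V) [FiniteDimensional ℝ W]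
    (hd : ∀ v ∈ W, B v v = 0 → v = 0) (f : W →ₗ[ℝ] ℝ) :
    ∃ g ∈ W, ∀ r : W, B g r = f r := by
  let Φ : W →ₗ[ℝ] (W →ₗ[ℝ] ℝ) := (B.domRestrict₁₂ W W)
  have hinj : Function.Injective Φ := by
    rw [injective_iff_map_eq_zero]
    intro v hv
    have h0 : Φ v v = 0 := by rw [hv]; rfl
    exact Subtype.ext (hd v v.2 h0)
  have hsurj : Function.Surjective Φ :=
    (LinearMap.injective_iff_surjective_of_finrank_eq_finrank
      (Subspace.dual_finrank_eq (K := ℝ) (V := W)).symm).1 hinj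
  obtain ⟨g, hg⟩ := hsurj f
  refine ⟨g, g.2, fun r => ?_⟩
  rw [← hg]; rfl

theorem exists_form_le_normSq {E : Type*} [NormedAddCommGroup E] [NormedSpace ℝ E]
    [FiniteDimensional ℝ E] (D : E →ₗ[ℝ] E →ₗ[ℝ] ℝ) :
    ∃ C : ℝ, 0 < C ∧ ∀ v, D v v ≤ C * ‖v‖ ^ 2 := by
  let D' : E →L[ℝ] (E →L[ℝ] ℝ) := LinearMap.toContinuousLinearMap
    ((LinearMap.toContinuousLinearMap (𝕜 := ℝ) (E := E) (F' := ℝ)).toLinearMap ∘ₗ D)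
  refine ⟨‖D'‖ + 1, by positivity, fun v => ?_⟩
  have h1 : D v v = D' v v := rfl
  rw [h1]
  calc D' v v ≤ ‖D' v v‖ := le_abs_self _
    _ ≤ ‖D'‖ * ‖v‖ * ‖v‖ := D'.le_opNorm₂ v v
    _ ≤ (‖D'‖ + 1) * ‖v‖ ^ 2 := by nlinarith [sq_nonneg ‖v‖]

/-- On a finite-dimensional space every quadratic form is bounded by a definite one. -/
theorem exists_form_le [FiniteDimensional ℝ V] (B : V →ₗ[ℝ] V →ₗ[ℝ] ℝ)
    (hB : ∀ v, 0 ≤ B v v) (hs : ∀ v w, B v w = B w v) (hd : ∀ v, B v v = 0 → v = 0)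
    (D : V →ₗ[ℝ] V →ₗ[ℝ] ℝ) : ∃ C : ℝ, 0 < C ∧ ∀ v, D v v ≤ C * B v v := by
  -- Taking B as the inner product makes the squared norm equal to B v v, so the claim becomes the
  -- continuity of D in finite dimension.
  let core : InnerProductSpace.Core ℝ V :=
    { inner := fun v w => B v w
      conj_inner_symm := fun v w => hs w v
      re_inner_nonneg := fun v => hB v
      add_left := fun u v w => by simp
      smul_left := fun u v r => by simp
      definite := hd }
  let ng : NormedAddCommGroup V := core.toNormedAddCommGroup
  let ip : InnerProductSpace ℝ V := InnerProductSpace.ofCore core.toCore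
  obtain ⟨C, hC, h⟩ := @exists_form_le_normSq V ng ip.toNormedSpace ‹_› D
  refine ⟨C, hC, fun v => (h v).trans_eq ?_⟩
  rw [← real_inner_self_eq_norm_sq v]
  rfl

end Forms

end RotRot

namespace RotRot

/-! ### Polynomial spaces -/

section Polynomials

open MvPolynomial

theorem mem_polySpace {m : ℤ} {p : Poly} :
    p ∈ polySpace m ↔ ∀ d ∈ p.support, (d.degree : ℤ) ≤ m :=
  mem_restrictSupport_iff ℝ

theorem monomial_mem_polySpace {m : ℤ} {d : Fin 2 →₀ ℕ} (hd : (d.degree : ℤ) ≤ m) (a : ℝ) :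
    monomial d a ∈ polySpace m :=
  (monomial_mem_restrictSupport ℝ).2 (Or.inl hd)

theorem polySpace_eq_span (m : ℤ) : polySpace m =
    Submodule.span ℝ ((fun d => monomial d (1 : ℝ)) '' {d : Fin 2 →₀ ℕ | (d.degree : ℤ) ≤ m}) :=
  restrictSupport_eq_span ℝ _

/-- Monomials span, so stability of degree under linear operations, and later the rotor–Koszul
decomposition, need only be checked on them. -/
theorem polySpace_le_iff {m : ℤ} {W : Submodule ℝ Poly} :
    polySpace m ≤ W ↔ ∀ d : Fin 2 →₀ ℕ, (d.degree : ℤ) ≤ m → monomial d (1 : ℝ) ∈ W := by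
  rw [polySpace_eq_span, Submodule.span_le, Set.image_subset_iff]
  rfl

theorem polySpace_mono {m n : ℤ} (h : m ≤ n) : polySpace m ≤ polySpace n :=
  restrictSupport_mono ℝ fun _ hd => le_trans hd h

theorem finite_degree_le (m : ℤ) : {d : Fin 2 →₀ ℕ | (d.degree : ℤ) ≤ m}.Finite :=
  (Finsupp.finite_of_degree_le m.toNat).subset fun d (hd : (d.degree : ℤ) ≤ m) => by
    change d.degree ≤ m.toNat
    omega

instance finiteDimensional_polySpace (m : ℤ) : FiniteDimensional ℝ (polySpace m) := by
  have : Finite {d : Fin 2 →₀ ℕ | (d.degree : ℤ) ≤ m} := finite_degree_le m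
  exact Module.Finite.of_basis (basisRestrictSupport ℝ _)

theorem mem_vecPolySpace {m : ℤ} {v : VecPoly} :
    v ∈ vecPolySpace m ↔ ∀ i, v i ∈ polySpace m := by
  simp [vecPolySpace, Submodule.mem_pi]

instance finiteDimensional_vecPolySpace (m : ℤ) : FiniteDimensional ℝ (vecPolySpace m) := by
  let f : vecPolySpace m →ₗ[ℝ] (Fin 2 → polySpace m) :=
    { toFun := fun v i => ⟨v.1 i, mem_vecPolySpace.1 v.2 i⟩
      map_add' := fun v w => rfl
      map_smul' := fun c v => rfl }
  refine FiniteDimensional.of_injective f fun v w h => Subtype.ext (funext fun i => ?_)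
  exact congrArg Subtype.val (congrFun h i)

instance finiteDimensional_edgePolySpace (E : Edge) (m : ℤ) :
    FiniteDimensional ℝ (edgePolySpace E m) := by
  unfold edgePolySpace; infer_instance

theorem pderiv_mem_polySpace {m : ℤ} {p : Poly} (hp : p ∈ polySpace (m + 1)) (i : Fin 2) :
    pderiv i p ∈ polySpace m := by
  suffices h : polySpace (m + 1) ≤ (polySpace m).comap (pderiv i).toLinearMap from h hp
  rw [polySpace_le_iff]
  intro d hd
  change pderiv i (monomial d (1 : ℝ)) ∈ polySpace m
  rw [pderiv_monomial]
  by_cases h0 : d i = 0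
  · simp [h0]
  · apply monomial_mem_polySpace
    have hdeg : (d - Finsupp.single i 1).degree + 1 = d.degree := by
      have h1 : d - Finsupp.single i 1 + Finsupp.single i 1 = d := by
        ext j
        by_cases hj : j = i
        · subst hj; simp; omega
        · simp [Finsupp.single_eq_of_ne hj]
      conv_rhs => rw [← h1]
      simp
    omega

theorem mul_mem_polySpace {m n : ℤ} {p q : Poly} (hp : p ∈ polySpace m) (hq : q ∈ polySpace n) :
    p * q ∈ polySpace (m + n) := by
  classical
  rw [mem_polySpace] at *
  intro d hd
  obtain ⟨a, ha, b, hb, rfl⟩ := Finset.mem_add.1 (support_mul p q hd)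
  have := hp a ha
  have := hq b hb
  rw [map_add]
  push_cast
  omega

theorem C_mem_polySpace {m : ℤ} (hm : 0 ≤ m) (a : ℝ) : (C a : Poly) ∈ polySpace m :=
  monomial_mem_polySpace (d := 0) (by simpa using hm) a

theorem X_mem_polySpace (i : Fin 2) : (X i : Poly) ∈ polySpace 1 :=
  monomial_mem_polySpace (by simp) 1

theorem pow_mem_polySpace {p : Poly} (hp : p ∈ polySpace 1) (n : ℕ) : p ^ n ∈ polySpace n := by
  induction n with
  | zero => simpa using C_mem_polySpace (le_refl 0) 1
  | succ n ih => rw [pow_succ]; push_cast; exact mul_mem_polySpace ih hp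

theorem vrot_mem_vecPolySpace {m : ℤ} {q : Poly} (hq : q ∈ polySpace (m + 1)) :
    vrot q ∈ vecPolySpace m := by
  rw [mem_vecPolySpace]
  intro i
  fin_cases i
  · exact pderiv_mem_polySpace hq 1
  · exact (polySpace m).neg_mem (pderiv_mem_polySpace hq 0)

theorem koszul_mem_vecPolySpace {m : ℤ} {r : Poly} (x₀ : Plane) (hr : r ∈ polySpace (m - 1)) :
    koszul x₀ r ∈ vecPolySpace m := by
  rw [mem_vecPolySpace]
  intro i
  have h := mul_mem_polySpace ((polySpace 1).sub_mem (X_mem_polySpace i)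
    (C_mem_polySpace zero_le_one (x₀ i))) hr
  rwa [show 1 + (m - 1) = m by ring] at h

/-! ### Affine changes of variables -/

/-- The affine change of variables `x ↦ x₀ + h x`. -/
noncomputable def affineSubst (x₀ : Plane) (h : ℝ) : Poly →ₐ[ℝ] Poly :=
  aeval fun i => C (x₀ i) + C h * X i

theorem affineSubst_mem_polySpace (x₀ : Plane) (h : ℝ) {m : ℤ} {p : Poly}
    (hp : p ∈ polySpace m) : affineSubst x₀ h p ∈ polySpace m := by
  suffices H : polySpace m ≤ (polySpace m).comap (affineSubst x₀ h).toLinearMap from H hp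
  rw [polySpace_le_iff]
  intro d hd
  change affineSubst x₀ h (monomial d 1) ∈ polySpace m
  have hX : ∀ i, (C (x₀ i) + C h * X i : Poly) ∈ polySpace 1 := fun i =>
    (polySpace 1).add_mem (C_mem_polySpace zero_le_one _)
      (by simpa using mul_mem_polySpace (C_mem_polySpace le_rfl h) (X_mem_polySpace i))
  rw [affineSubst, aeval_monomial, Finsupp.prod_fintype _ _ (by simp), Fin.prod_univ_two,
    map_one, one_mul]
  refine polySpace_mono ?_ (mul_mem_polySpace (pow_mem_polySpace (hX 0) (d 0))
    (pow_mem_polySpace (hX 1) (d 1)))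
  rw [Finsupp.degree_eq_sum, Fin.sum_univ_two] at hd
  exact_mod_cast hd

theorem affineSubst_affineSubst_inv (x₀ : Plane) {h : ℝ} (hh : h ≠ 0) (p : Poly) :
    affineSubst x₀ h (affineSubst (-h⁻¹ • x₀) h⁻¹ p) = p := by
  suffices H : (affineSubst x₀ h).comp (affineSubst (-h⁻¹ • x₀) h⁻¹) = AlgHom.id ℝ Poly from
    DFunLike.congr_fun H p
  refine algHom_ext fun i => ?_
  simp only [affineSubst, AlgHom.comp_apply, aeval_X, map_add, map_mul, algHom_C, algebraMap_eq,
    AlgHom.id_apply, PiLp.smul_apply, smul_eq_mul]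
  rw [mul_add, ← mul_assoc, ← C_mul, ← C_mul (a := h⁻¹) (a' := h), inv_mul_cancel₀ hh, ← add_assoc]
  simp

theorem affineSubst_inv_affineSubst (x₀ : Plane) {h : ℝ} (hh : h ≠ 0) (p : Poly) :
    affineSubst (-h⁻¹ • x₀) h⁻¹ (affineSubst x₀ h p) = p := by
  have := affineSubst_affineSubst_inv (-h⁻¹ • x₀) (inv_ne_zero hh) p
  rwa [inv_inv, smul_smul, neg_mul_neg, mul_inv_cancel₀ hh, one_smul] at this

theorem pderiv_affineSubst (x₀ : Plane) (h : ℝ) (i : Fin 2) (p : Poly) :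
    pderiv i (affineSubst x₀ h p) = h • affineSubst x₀ h (pderiv i p) := by
  induction p using MvPolynomial.induction_on with
  | C a => simp [affineSubst]
  | add p q hp hq => simp [hp, hq]
  | mul_X p j hp =>
    simp only [map_mul, Derivation.leibniz, hp, smul_eq_mul, map_add]
    by_cases hj : j = i
    · subst hj; simp [affineSubst, smul_eq_C_mul]; ring
    · simp [affineSubst, smul_eq_C_mul, pderiv_X_of_ne hj]; ring

theorem evalAt_affineSubst (x₀ : Plane) (h : ℝ) (p : Poly) (x : Plane) :
    evalAt x (affineSubst x₀ h p) = evalAt (x₀ + h • x) p := by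
  induction p using MvPolynomial.induction_on with
  | C a => simp [affineSubst, evalAt]
  | add p q hp hq => simp only [evalAt, map_add] at *; rw [hp, hq]
  | mul_X p j hp =>
    simp only [evalAt, map_mul] at *
    rw [hp]
    simp [affineSubst]

/-! ### Rotors and Koszul fields -/

theorem coeff_X_mul_pderiv (i : Fin 2) (q : Poly) (d : Fin 2 →₀ ℕ) :
    coeff d (X i * pderiv i q) = d i * coeff d q := by
  induction q using MvPolynomial.induction_on' with
  | monomial u a =>
    rw [X_mul_pderiv_monomial, coeff_smul, coeff_monomial]
    split_ifs with h
    · subst h; simp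
    · simp
  | add p q hp hq => rw [map_add, mul_add, coeff_add, hp, hq, coeff_add, mul_add]

/-- The sum of the rotors and of the Koszul complement at the origin is direct. -/
theorem eq_C_of_vrot_add_koszul_zero {q r : Poly} (h : vrot q + koszul 0 r = 0) :
    q = C (coeff 0 q) := by
  have h0 : pderiv 1 q + X 0 * r = 0 := by simpa [vrot, koszul] using congrFun h 0
  have h1 : -pderiv 0 q + X 1 * r = 0 := by simpa [vrot, koszul] using congrFun h 1
  -- Eliminating r leaves the Euler equation x·∇q = 0. The Euler operator multiplies each monomial
  -- by its degree, so only the constant term of q survives.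
  have h2 : X 0 * pderiv 0 q + X 1 * pderiv 1 q = 0 := by
    linear_combination (X 1) * h0 - X 0 * h1
  ext d
  have h3 := congrArg (coeff d) h2
  rw [coeff_add, coeff_X_mul_pderiv, coeff_X_mul_pderiv, coeff_zero, ← add_mul] at h3
  rw [coeff_C]
  split_ifs with hd
  · rw [hd]
  · refine (mul_eq_zero.1 h3).resolve_left fun h4 => hd ?_
    have h5 : d 0 + d 1 = 0 := by exact_mod_cast h4
    ext i
    fin_cases i <;> simp <;> omega

theorem affineSubst_vrot (x₀ : Plane) {h : ℝ} (hh : h ≠ 0) (q : Poly) (i : Fin 2) :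
    affineSubst x₀ h (vrot q i) = h⁻¹ • vrot (affineSubst x₀ h q) i := by
  fin_cases i <;> simp [vrot, pderiv_affineSubst, smul_smul, hh]

theorem affineSubst_koszul (x₀ : Plane) (h : ℝ) (r : Poly) (i : Fin 2) :
    affineSubst x₀ h (koszul x₀ r i) = h • koszul 0 (affineSubst x₀ h r) i := by
  simp [koszul, affineSubst, smul_eq_C_mul]
  ring

/-- Translation by x₀, the affine substitution with h = 1, moves the Koszul centre to the origin. -/
theorem vrot_eq_zero_of_vrot_add_koszul {x₀ : Plane} {q r : Poly} (h : vrot q + koszul x₀ r = 0) :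
    q = C (coeff 0 (affineSubst x₀ 1 q)) := by
  have h1 : vrot (affineSubst x₀ 1 q) + koszul 0 (affineSubst x₀ 1 r) = 0 := by
    ext1 i
    have := congrArg (affineSubst x₀ 1) (congrFun h i)
    rw [Pi.add_apply, map_add, affineSubst_vrot x₀ one_ne_zero, affineSubst_koszul] at this
    simpa using this
  have h2 := congrArg (affineSubst (-(1:ℝ)⁻¹ • x₀) 1⁻¹) (eq_C_of_vrot_add_koszul_zero h1)
  rw [affineSubst_inv_affineSubst x₀ one_ne_zero] at h2
  simpa [affineSubst] using h2

theorem vrot_C (a : ℝ) : vrot (C a) = 0 := by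
  ext1 i
  fin_cases i <;> simp [vrot]

/-- Every polynomial vector field is the sum of a rotor and of a field in the Koszul complement. -/
theorem vecPolySpace_le (m : ℤ) : vecPolySpace m ≤
    (polySpace (m + 1)).map vrot ⊔ (polySpace (m - 1)).map (koszul 0) := by
  set W := (polySpace (m + 1)).map vrot ⊔ (polySpace (m - 1)).map (koszul 0) with hW
  have hq : ∀ (i : Fin 2) (c : ℝ) (M : Poly), M ∈ polySpace m →
      C c * (X i * M) ∈ polySpace (m + 1) := fun i c M hM => by
    rw [C_mul', add_comm]
    exact Submodule.smul_mem _ _ (mul_mem_polySpace (X_mem_polySpace i) hM)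
  have hr : ∀ (i : Fin 2) (c : ℝ) (M : Poly), M ∈ polySpace m →
      C c * pderiv i M ∈ polySpace (m - 1) := fun i c M hM => by
    rw [C_mul']
    exact Submodule.smul_mem _ _ (pderiv_mem_polySpace (by simpa using hM) i)
  -- With c = 1/(1 + deg M), the Euler identity gives (M, 0) = rot(c x₁M) + x c∂₀M and (0, M) =
  -- rot(-c x₀M) + x c∂₁M for a monomial M, with coordinates indexed 0 and 1.
  have key : ∀ d : Fin 2 →₀ ℕ, (d.degree : ℤ) ≤ m → ∃ c : ℝ, C c * (1 + C (d 0 : ℝ) + C (d 1 : ℝ)) = (1 : Poly) ∧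
      monomial d (1 : ℝ) ∈ polySpace m ∧
      X 0 * pderiv 0 (monomial d (1 : ℝ)) = C (d 0 : ℝ) * monomial d (1 : ℝ) ∧
      X 1 * pderiv 1 (monomial d (1 : ℝ)) = C (d 1 : ℝ) * monomial d (1 : ℝ) := fun d hd => by
    refine ⟨(1 + d 0 + d 1 : ℝ)⁻¹, ?_, monomial_mem_polySpace hd 1, ?_, ?_⟩
    · rw [← C_1, ← C_add, ← C_add, ← C_mul, inv_mul_cancel₀ (by positivity)]
    · rw [X_mul_pderiv_monomial]; simp [nsmul_eq_mul]
    · rw [X_mul_pderiv_monomial]; simp [nsmul_eq_mul]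
  have h0 : polySpace m ≤ W.comap (LinearMap.single ℝ (fun _ : Fin 2 => Poly) 0) := by
    rw [polySpace_le_iff]
    intro d hd
    obtain ⟨c, hc, hM, e0, e1⟩ := key d hd
    generalize (monomial d (1 : ℝ) : Poly) = M at hM e0 e1 ⊢
    refine Submodule.mem_sup.2 ⟨_, Submodule.mem_map_of_mem (hq 1 (c) _ hM), _,
      Submodule.mem_map_of_mem (hr 0 c _ hM), ?_⟩
    ext1 i
    fin_cases i
    · simp [vrot, koszul]
      linear_combination C c * e0 + C c * e1 + M * hc
    · simp [vrot, koszul]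
      ring
  have h1 : polySpace m ≤ W.comap (LinearMap.single ℝ (fun _ : Fin 2 => Poly) 1) := by
    rw [polySpace_le_iff]
    intro d hd
    obtain ⟨c, hc, hM, e0, e1⟩ := key d hd
    generalize (monomial d (1 : ℝ) : Poly) = M at hM e0 e1 ⊢
    refine Submodule.mem_sup.2 ⟨_, Submodule.mem_map_of_mem (hq 0 (-c) _ hM), _,
      Submodule.mem_map_of_mem (hr 1 c _ hM), ?_⟩
    ext1 i
    fin_cases i
    · simp [vrot, koszul]
      ring
    · simp [vrot, koszul]
      linear_combination C c * e0 + C c * e1 + M * hc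
  intro v hv
  rw [mem_vecPolySpace] at hv
  have hsplit : v = LinearMap.single ℝ (fun _ : Fin 2 => Poly) 0 (v 0)
      + LinearMap.single ℝ (fun _ : Fin 2 => Poly) 1 (v 1) := by
    ext1 i
    fin_cases i <;> simp
  rw [hsplit]
  exact W.add_mem (h0 (hv 0)) (h1 (hv 1))

end Polynomials

end RotRot

namespace RotRot

open MeasureTheory Polynomial

/-! ### Integrals over elements -/

section ElementIntegrals

theorem continuous_evalAt (p : Poly) : Continuous fun x => evalAt x p :=
  (MvPolynomial.continuous_eval p).comp (by fun_prop)

theorem integrableOn_evalAt {T : Set Plane} (hT : Bornology.IsBounded T) (p : Poly) :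
    IntegrableOn (fun x => evalAt x p) T := by
  have hc : IsCompact (closure T) := hT.isCompact_closure
  exact ((continuous_evalAt p).continuousOn.integrableOn_compact hc).mono_set subset_closure

/-- The integral over a bounded set as a linear form. -/
noncomputable def intElemₗ {T : Set Plane} (hT : Bornology.IsBounded T) : Poly →ₗ[ℝ] ℝ where
  toFun := intElem T
  map_add' p q := by
    simp only [intElem, evalAt, map_add]
    exact integral_add (integrableOn_evalAt hT p) (integrableOn_evalAt hT q)
  map_smul' c p := by
    simp only [intElem, evalAt, MvPolynomial.smul_eval, smul_eq_mul, RingHom.id_apply]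
    exact integral_const_mul c _

/-- The `L²`-product of polynomials over a bounded set. -/
noncomputable def elemForm {T : Set Plane} (hT : Bornology.IsBounded T) :
    Poly →ₗ[ℝ] Poly →ₗ[ℝ] ℝ :=
  (LinearMap.mul ℝ Poly).compr₂ (intElemₗ hT)

@[simp]
theorem elemForm_apply {T : Set Plane} (hT : Bornology.IsBounded T) (p q : Poly) :
    elemForm hT p q = intElem T (p * q) := rfl

/-- The `L²`-product of polynomial vector fields over a bounded set. -/
noncomputable def vecForm {T : Set Plane} (hT : Bornology.IsBounded T) :
    VecPoly →ₗ[ℝ] VecPoly →ₗ[ℝ] ℝ :=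
  (LinearMap.mk₂ ℝ dot
    (fun _ _ _ => by simp only [dot, Pi.add_apply]; ring)
    (fun _ _ _ => by simp [dot])
    (fun _ _ _ => by simp only [dot, Pi.add_apply]; ring)
    (fun _ _ _ => by simp [dot])).compr₂ (intElemₗ hT)

@[simp]
theorem vecForm_apply {T : Set Plane} (hT : Bornology.IsBounded T) (v w : VecPoly) :
    vecForm hT v w = intElem T (dot v w) := rfl

theorem intElem_dot {T : Set Plane} (hT : Bornology.IsBounded T) (v w : VecPoly) :
    intElem T (dot v w) = intElem T (v 0 * w 0) + intElem T (v 1 * w 1) :=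
  (intElemₗ hT).map_add _ _

theorem intElem_mul_self_nonneg (T : Set Plane) (p : Poly) : 0 ≤ intElem T (p * p) :=
  integral_nonneg fun x => by simpa [evalAt] using mul_self_nonneg _

theorem intElem_dot_self_nonneg (T : Set Plane) (v : VecPoly) : 0 ≤ intElem T (dot v v) :=
  integral_nonneg fun x => by
    simpa [evalAt, dot] using add_nonneg (mul_self_nonneg _) (mul_self_nonneg _)

theorem dot_comm (v w : VecPoly) : dot v w = dot w v := by
  simp only [dot]; ring

theorem intElem_mul_sq_le {T : Set Plane} (hT : Bornology.IsBounded T) (p q : Poly) :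
    intElem T (p * q) ^ 2 ≤ intElem T (p * p) * intElem T (q * q) :=
  form_sq_le (B := elemForm hT) (intElem_mul_self_nonneg T)
    (fun p q => by simp [mul_comm]) p q

theorem intElem_dot_sq_le {T : Set Plane} (hT : Bornology.IsBounded T) (v w : VecPoly) :
    intElem T (dot v w) ^ 2 ≤ intElem T (dot v v) * intElem T (dot w w) :=
  form_sq_le (B := vecForm hT) (intElem_dot_self_nonneg T)
    (fun p q => by simp [dot_comm]) v w

/-- The ball contains a square of side r, a product of infinite sets, and a polynomial vanishing on
such a product is zero. -/
theorem eq_zero_of_evalAt_eq_zero_on_ball {x₀ : Plane} {r : ℝ} (hr : 0 < r) {p : Poly}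
    (hp : ∀ x ∈ Metric.ball x₀ r, evalAt x p = 0) : p = 0 := by
  refine MvPolynomial.funext_set (fun i => Set.Ioo (x₀ i - r / 2) (x₀ i + r / 2))
    (fun i => Set.Ioo_infinite (by linarith)) fun x hx => ?_
  have h0 := hx 0 (Set.mem_univ _)
  have h1 := hx 1 (Set.mem_univ _)
  have hx' : WithLp.toLp 2 x ∈ Metric.ball x₀ r := by
    rw [Metric.mem_ball, EuclideanSpace.dist_eq, Real.sqrt_lt' hr, Fin.sum_univ_two,
      Real.dist_eq, Real.dist_eq, sq_abs, sq_abs]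
    simp only [Set.mem_Ioo] at h0 h1
    nlinarith
  simpa [evalAt] using hp _ hx'

theorem eq_zero_of_intElem_mul_self {T : Set Plane} (hT : Bornology.IsBounded T) {x₀ : Plane}
    {r : ℝ} (hr : 0 < r) (hball : Metric.ball x₀ r ⊆ T) {p : Poly}
    (hp : intElem T (p * p) = 0) : p = 0 := by
  have hnn : ∀ x, 0 ≤ evalAt x (p * p) := fun x => by
    simpa [evalAt] using mul_self_nonneg (MvPolynomial.eval (fun i => x i) p)
  have h1 : ∫ x in Metric.ball x₀ r, evalAt x (p * p) = 0 := by
    refine le_antisymm ?_ (integral_nonneg hnn)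
    rw [← hp]
    exact setIntegral_mono_set (integrableOn_evalAt hT _) (Filter.Eventually.of_forall hnn)
      hball.eventuallyLE
  rw [setIntegral_eq_zero_iff_of_nonneg_ae (Filter.Eventually.of_forall hnn)
    (integrableOn_evalAt Metric.isBounded_ball _)] at h1
  have h2 := Measure.eqOn_open_of_ae_eq h1 Metric.isOpen_ball
    (continuous_evalAt (p * p)).continuousOn continuousOn_const
  refine eq_zero_of_evalAt_eq_zero_on_ball (x₀ := x₀) hr fun x hx => ?_
  simpa [evalAt] using h2 hx

theorem eq_zero_of_intElem_dot_self {T : Set Plane} (hT : Bornology.IsBounded T) {x₀ : Plane}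
    {r : ℝ} (hr : 0 < r) (hball : Metric.ball x₀ r ⊆ T) {v : VecPoly}
    (hv : intElem T (dot v v) = 0) : v = 0 := by
  rw [intElem_dot hT] at hv
  have h0 := intElem_mul_self_nonneg T (v 0)
  have h1 := intElem_mul_self_nonneg T (v 1)
  have e0 : v 0 = 0 := eq_zero_of_intElem_mul_self hT hr hball (by linarith)
  have e1 : v 1 = 0 := eq_zero_of_intElem_mul_self hT hr hball (by linarith)
  ext1 i
  fin_cases i
  · exact e0
  · exact e1

theorem intElem_ball_affineSubst (x₀ : Plane) {h : ℝ} (hh : 0 < h) {r : ℝ} (p : Poly) :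
    h ^ 2 * intElem (Metric.ball 0 r) (affineSubst x₀ h p)
      = intElem (Metric.ball x₀ (r * h)) p := by
  have htr := (measurePreserving_add_left volume x₀).setIntegral_preimage_emb
    (MeasurableEquiv.addLeft x₀).measurableEmbedding (fun x => evalAt x p)
    (Metric.ball x₀ (r * h))
  simp only [intElem, evalAt_affineSubst]
  rw [Measure.setIntegral_comp_smul_of_pos volume (fun x => evalAt (x₀ + x) p) _ hh,
    smul_ball hh.ne', smul_zero, Real.norm_of_nonneg hh.le, finrank_euclideanSpace_fin,
    smul_eq_mul, ← mul_assoc, mul_inv_cancel₀ (by positivity), one_mul, ← htr]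
  congr 2
  ext x
  simp [mul_comm]

end ElementIntegrals

/-! ### Polynomials on sets comparable to a disk -/

section Comparable

/-- `T` is an open set comparable to the disk of centre `x₀` and radius `h`. -/
structure ComparableToDisk (ρ : ℝ) (T : Set Plane) (x₀ : Plane) (h : ℝ) : Prop where
  pos : 0 < h
  isOpen : IsOpen T
  ball_subset : Metric.ball x₀ (ρ * h) ⊆ T
  subset_closedBall : T ⊆ Metric.closedBall x₀ h

theorem ComparableToDisk.isBounded {ρ h : ℝ} {T : Set Plane} {x₀ : Plane}
    (H : ComparableToDisk ρ T x₀ h) : Bornology.IsBounded T :=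
  Metric.isBounded_closedBall.subset H.subset_closedBall

/-- Monomials are at most 1 in modulus on the unit disk. The point of the bound is that its
right-hand side is a quadratic form in p, independent of x, to which `exists_form_le_elem` applies.
-/
theorem evalAt_sq_le_sum_coeff {m : ℤ} {p : Poly} (hp : p ∈ polySpace m) {x : Plane}
    (hx : x ∈ Metric.closedBall 0 1) :
    evalAt x p ^ 2 ≤ (finite_degree_le m).toFinset.card *
      ∑ d ∈ (finite_degree_le m).toFinset, MvPolynomial.coeff d p ^ 2 := by
  have hxi : ∀ i, |x i| ≤ 1 := fun i =>
    (PiLp.norm_apply_le x i).trans (by simpa using hx)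
  have hsub : p.support ⊆ (finite_degree_le m).toFinset := fun d hd => by
    simpa using mem_polySpace.1 hp d hd
  have h1 : evalAt x p = ∑ d ∈ (finite_degree_le m).toFinset,
      MvPolynomial.coeff d p * ∏ i, x i ^ d i := by
    rw [evalAt, MvPolynomial.eval_eq']
    refine Finset.sum_subset hsub fun d _ hd => ?_
    rw [MvPolynomial.notMem_support_iff.1 hd, zero_mul]
  have h2 : ∀ d : Fin 2 →₀ ℕ, (MvPolynomial.coeff d p * ∏ i, x i ^ d i) ^ 2
      ≤ MvPolynomial.coeff d p ^ 2 := fun d => by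
    rw [mul_pow]
    refine mul_le_of_le_one_right (sq_nonneg _) ?_
    rw [sq_le_one_iff_abs_le_one, Finset.abs_prod]
    exact Finset.prod_le_one (fun _ _ => abs_nonneg _) fun i _ => by
      rw [abs_pow]; exact pow_le_one₀ (abs_nonneg _) (hxi i)
  rw [h1]
  refine sq_sum_le_card_mul_sum_sq.trans ?_
  exact mul_le_mul_of_nonneg_left (Finset.sum_le_sum fun d _ => h2 d) (Nat.cast_nonneg _)

/-- On a finite-dimensional polynomial space, quadratic forms are controlled by the `L²`-norm. -/
theorem exists_form_le_elem {ρ : ℝ} (hρ : 0 < ρ) (m : ℤ) (D : polySpace m →ₗ[ℝ] polySpace m →ₗ[ℝ] ℝ) :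
    ∃ C : ℝ, 0 < C ∧ ∀ p : polySpace m,
      D p p ≤ C * intElem (Metric.ball 0 ρ) ((p : Poly) * p) := by
  exact exists_form_le ((elemForm Metric.isBounded_ball).domRestrict₁₂ (polySpace m) (polySpace m))
    (fun p => intElem_mul_self_nonneg _ (p : Poly))
    (fun p q => by simp [LinearMap.domRestrict₁₂_apply, mul_comm])
    (fun p hp => Subtype.ext (eq_zero_of_intElem_mul_self (x₀ := 0) (r := ρ)
      Metric.isBounded_ball hρ subset_rfl hp)) D

theorem exists_form_le_vec {ρ : ℝ} (hρ : 0 < ρ) (m : ℤ)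
    (D : vecPolySpace m →ₗ[ℝ] vecPolySpace m →ₗ[ℝ] ℝ) :
    ∃ C : ℝ, 0 < C ∧ ∀ v : vecPolySpace m,
      D v v ≤ C * intElem (Metric.ball 0 ρ) (dot (v : VecPoly) v) := by
  exact exists_form_le
    ((vecForm Metric.isBounded_ball).domRestrict₁₂ (vecPolySpace m) (vecPolySpace m))
    (fun p => intElem_dot_self_nonneg _ (p : VecPoly))
    (fun p q => by simp [LinearMap.domRestrict₁₂_apply, dot_comm])
    (fun p hp => Subtype.ext (eq_zero_of_intElem_dot_self (x₀ := 0) (r := ρ)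
      Metric.isBounded_ball hρ subset_rfl hp)) D

theorem exists_evalAt_sq_le {ρ : ℝ} (hρ : 0 < ρ) (m : ℤ) :
    ∃ C : ℝ, 0 < C ∧ ∀ p ∈ polySpace m, ∀ x ∈ Metric.closedBall (0 : Plane) 1,
      evalAt x p ^ 2 ≤ C * intElem (Metric.ball 0 ρ) (p * p) := by
  let F := (finite_degree_le m).toFinset
  let L : (Fin 2 →₀ ℕ) → polySpace m →ₗ[ℝ] ℝ := fun d =>
    (MvPolynomial.lcoeff ℝ d).domRestrict (polySpace m)
  obtain ⟨C, hC, h⟩ := exists_form_le_elem hρ m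
    ((F.card : ℝ) • ∑ d ∈ F, (LinearMap.mul ℝ ℝ).compl₁₂ (L d) (L d))
  refine ⟨C, hC, fun p hp x hx => (evalAt_sq_le_sum_coeff hp hx).trans (le_trans ?_ (h ⟨p, hp⟩))⟩
  simp [L, F, sq, LinearMap.sum_apply]

theorem ComparableToDisk.scaled_intElem_le {ρ h : ℝ} {T : Set Plane} {x₀ : Plane}
    (H : ComparableToDisk ρ T x₀ h) (p : Poly) :
    h ^ 2 * intElem (Metric.ball 0 ρ) (affineSubst x₀ h p * affineSubst x₀ h p)
      ≤ intElem T (p * p) := by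
  rw [← map_mul, intElem_ball_affineSubst x₀ H.pos]
  refine setIntegral_mono_set (integrableOn_evalAt H.isBounded _)
    (Filter.Eventually.of_forall fun x => ?_) H.ball_subset.eventuallyLE
  simpa [evalAt] using mul_self_nonneg _

/-- Pulled back to the reference disk, p is controlled on the whole unit disk by its L²-norm on the
disk of radius ρ. The first conclusion is thus an L^∞–L² inverse inequality, valid even on points of
the large disk outside T. The second is the converse of `scaled_intElem_le`. The shape of T between
the two disks plays no role. -/
theorem exists_evalAt_sq_le_intElem {ρ : ℝ} (hρ : 0 < ρ) (m : ℤ) :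
    ∃ C : ℝ, 0 < C ∧ ∀ T x₀ h, ComparableToDisk ρ T x₀ h → ∀ p ∈ polySpace m,
      (∀ x ∈ Metric.closedBall x₀ h, h ^ 2 * evalAt x p ^ 2 ≤ C * intElem T (p * p)) ∧
      intElem T (p * p) ≤ C * (h ^ 2 *
        intElem (Metric.ball 0 ρ) (affineSubst x₀ h p * affineSubst x₀ h p)) := by
  obtain ⟨C, hC, hle⟩ := exists_evalAt_sq_le hρ m
  set ω : ℝ := (volume (Metric.ball (0 : Plane) 1)).toReal with hω
  have hω0 : 0 ≤ ω := ENNReal.toReal_nonneg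
  -- The area h²ω of the large disk bounds the measure of T when the pointwise bound is integrated.
  refine ⟨C * (1 + ω), by positivity, fun T x₀ h H p hp => ?_⟩
  have hh := H.pos
  set A := intElem (Metric.ball 0 ρ) (affineSubst x₀ h p * affineSubst x₀ h p) with hA
  have hA0 : 0 ≤ A := intElem_mul_self_nonneg _ _
  have hpt : ∀ x ∈ Metric.closedBall x₀ h, evalAt x p ^ 2 ≤ C * A := fun x hx => by
    have hy : h⁻¹ • (x - x₀) ∈ Metric.closedBall (0 : Plane) 1 := by
      rw [mem_closedBall_zero_iff, norm_smul, norm_inv, Real.norm_of_nonneg hh.le,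
        inv_mul_le_one₀ hh, ← dist_eq_norm]
      exact hx
    have := hle _ (affineSubst_mem_polySpace x₀ h hp) _ hy
    rwa [evalAt_affineSubst, smul_smul, mul_inv_cancel₀ hh.ne', one_smul, add_sub_cancel] at this
  have hN := H.scaled_intElem_le p
  refine ⟨fun x hx => ?_, ?_⟩
  · calc h ^ 2 * evalAt x p ^ 2 ≤ h ^ 2 * (C * A) := by gcongr; exact hpt x hx
      _ = C * (h ^ 2 * A) := by ring
      _ ≤ C * intElem T (p * p) := by gcongr
      _ ≤ C * (1 + ω) * intElem T (p * p) := by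
        have := intElem_mul_self_nonneg T p
        gcongr
        nlinarith
  · have hvol : volume.real T ≤ h ^ 2 * ω := by
      have h1 : volume.real (Metric.closedBall x₀ h) = h ^ 2 * ω := by
        rw [Measure.real, Measure.addHaar_closedBall volume x₀ hh.le, ENNReal.toReal_mul,
          finrank_euclideanSpace_fin, ENNReal.toReal_ofReal (by positivity)]
      rw [← h1]
      exact measureReal_mono H.subset_closedBall measure_closedBall_lt_top.ne
    calc intElem T (p * p) ≤ ∫ x in T, C * A := by
          refine setIntegral_mono_on (integrableOn_evalAt H.isBounded _) ?_
            H.isOpen.measurableSet fun x hx => ?_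
          · exact integrableOn_const H.isBounded.measure_lt_top.ne
          · have := hpt x (H.subset_closedBall hx)
            simpa [evalAt, sq] using this
      _ = volume.real T * (C * A) := by rw [setIntegral_const, smul_eq_mul]
      _ ≤ (h ^ 2 * ω) * (C * A) := by gcongr
      _ ≤ C * (1 + ω) * (h ^ 2 * A) := by
        have : 0 ≤ C * (h ^ 2 * A) := by positivity
        nlinarith

end Comparable

end RotRot

namespace RotRot

open MeasureTheory Polynomial

/-! ### Scaled estimates for vector fields -/

section VectorEstimates

/-- The affine change of variables on polynomial vector fields. -/
noncomputable def affineSubstVec (x₀ : Plane) (h : ℝ) (v : VecPoly) : VecPoly :=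
  fun i => affineSubst x₀ h (v i)

theorem affineSubstVec_vrot (x₀ : Plane) {h : ℝ} (hh : h ≠ 0) (q : Poly) :
    affineSubstVec x₀ h (vrot q) = h⁻¹ • vrot (affineSubst x₀ h q) :=
  funext fun i => affineSubst_vrot x₀ hh q i

theorem affineSubstVec_koszul (x₀ : Plane) (h : ℝ) (r : Poly) :
    affineSubstVec x₀ h (koszul x₀ r) = h • koszul 0 (affineSubst x₀ h r) :=
  funext fun i => affineSubst_koszul x₀ h r i

theorem affineSubstVec_add (x₀ : Plane) (h : ℝ) (v w : VecPoly) :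
    affineSubstVec x₀ h (v + w) = affineSubstVec x₀ h v + affineSubstVec x₀ h w :=
  funext fun _ => map_add _ _ _

theorem affineSubstVec_injective (x₀ : Plane) {h : ℝ} (hh : h ≠ 0) :
    Function.Injective (affineSubstVec x₀ h) := fun v w hvw => funext fun i => by
  have h1 := congrArg (affineSubst (-h⁻¹ • x₀) h⁻¹) (congrFun hvw i)
  simpa only [affineSubstVec, affineSubst_inv_affineSubst x₀ hh] using h1

theorem affineSubstVec_mem {x₀ : Plane} {h : ℝ} {m : ℤ} {v : VecPoly} (hv : v ∈ vecPolySpace m) :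
    affineSubstVec x₀ h v ∈ vecPolySpace m :=
  mem_vecPolySpace.2 fun i => affineSubst_mem_polySpace x₀ h (mem_vecPolySpace.1 hv i)

theorem dot_smul_self (c : ℝ) (v : VecPoly) : dot (c • v) (c • v) = c ^ 2 • dot v v := by
  simp only [dot, Pi.smul_apply, MvPolynomial.smul_eq_C_mul, map_pow]
  ring

theorem intElem_smul {T : Set Plane} (hT : Bornology.IsBounded T) (c : ℝ) (p : Poly) :
    intElem T (c • p) = c * intElem T p :=
  (intElemₗ hT).map_smul c p

theorem ComparableToDisk.scaled_intElem_dot_le {ρ h : ℝ} {T : Set Plane} {x₀ : Plane}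
    (H : ComparableToDisk ρ T x₀ h) (v : VecPoly) :
    h ^ 2 * intElem (Metric.ball 0 ρ) (dot (affineSubstVec x₀ h v) (affineSubstVec x₀ h v))
      ≤ intElem T (dot v v) := by
  rw [intElem_dot H.isBounded, intElem_dot Metric.isBounded_ball, mul_add]
  exact add_le_add (H.scaled_intElem_le (v 0)) (H.scaled_intElem_le (v 1))

theorem exists_intElem_dot_le {ρ : ℝ} (hρ : 0 < ρ) (m : ℤ) :
    ∃ C : ℝ, 0 < C ∧ ∀ T x₀ h, ComparableToDisk ρ T x₀ h → ∀ v ∈ vecPolySpace m,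
      intElem T (dot v v) ≤ C * (h ^ 2 *
        intElem (Metric.ball 0 ρ) (dot (affineSubstVec x₀ h v) (affineSubstVec x₀ h v))) := by
  obtain ⟨C, hC, hle⟩ := exists_evalAt_sq_le_intElem hρ m
  refine ⟨C, hC, fun T x₀ h H v hv => ?_⟩
  rw [mem_vecPolySpace] at hv
  rw [intElem_dot H.isBounded, intElem_dot Metric.isBounded_ball, mul_add, mul_add]
  exact add_le_add (hle T x₀ h H _ (hv 0)).2 (hle T x₀ h H _ (hv 1)).2

/-- The inverse inequality for the vector rotor. -/
theorem exists_intElem_vrot_le {ρ : ℝ} (hρ : 0 < ρ) (m : ℤ) :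
    ∃ C : ℝ, 0 < C ∧ ∀ T x₀ h, ComparableToDisk ρ T x₀ h → ∀ q ∈ polySpace m,
      h ^ 2 * intElem T (dot (vrot q) (vrot q)) ≤ C * intElem T (q * q) := by
  obtain ⟨C₁, hC₁, h₁⟩ := exists_intElem_dot_le hρ m
  obtain ⟨C₂, hC₂, h₂⟩ := exists_form_le_elem hρ m
    ((vecForm (T := Metric.ball 0 ρ) Metric.isBounded_ball).compl₁₂
      (vrot ∘ₗ (polySpace m).subtype) (vrot ∘ₗ (polySpace m).subtype))
  refine ⟨C₁ * C₂, by positivity, fun T x₀ h H q hq => ?_⟩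
  have hh := H.pos
  have e₁ := h₁ T x₀ h H (vrot q) (vrot_mem_vecPolySpace (polySpace_mono (by omega) hq))
  have e₂ := h₂ ⟨_, affineSubst_mem_polySpace x₀ h hq⟩
  have e₃ := H.scaled_intElem_le q
  simp only [LinearMap.compl₁₂_apply, LinearMap.comp_apply, Submodule.subtype_apply,
    vecForm_apply] at e₂
  -- The factor h⁻² from the chain rule cancels the Jacobian h²; this is why the inverse inequality
  -- carries h² on its left.
  rw [affineSubstVec_vrot x₀ hh.ne', dot_smul_self, intElem_smul Metric.isBounded_ball,
    ← mul_assoc (h ^ 2), inv_pow, mul_inv_cancel₀ (by positivity), one_mul] at e₁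
  calc h ^ 2 * intElem T (dot (vrot q) (vrot q))
      ≤ h ^ 2 * (C₁ * (C₂ * intElem (Metric.ball 0 ρ)
        (affineSubst x₀ h q * affineSubst x₀ h q))) := by
        gcongr
        exact e₁.trans (by gcongr)
    _ = C₁ * C₂ * (h ^ 2 * intElem (Metric.ball 0 ρ)
        (affineSubst x₀ h q * affineSubst x₀ h q)) := by ring
    _ ≤ C₁ * C₂ * intElem T (q * q) := by gcongr

/-- A linear choice of the decomposition of vector fields as a rotor plus a Koszul field. -/
theorem exists_decomposition (m : ℤ) :
    ∃ G : vecPolySpace m →ₗ[ℝ] polySpace (m + 1) × polySpace (m - 1),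
      ∀ z, vrot (G z).1 + koszul 0 (G z).2 = (z : VecPoly) := by
  let Φ : polySpace (m + 1) × polySpace (m - 1) →ₗ[ℝ] vecPolySpace m :=
    LinearMap.coprod
      ((vrot ∘ₗ (polySpace (m + 1)).subtype).codRestrict _ fun q => vrot_mem_vecPolySpace q.2)
      ((koszul 0 ∘ₗ (polySpace (m - 1)).subtype).codRestrict _
        fun r => koszul_mem_vecPolySpace 0 r.2)
  have hΦ : Φ.range = ⊤ := by
    rw [LinearMap.range_eq_top]
    intro z
    obtain ⟨_, ⟨q, hq, rfl⟩, _, ⟨r, hr, rfl⟩, hz⟩ := Submodule.mem_sup.1 (vecPolySpace_le m z.2)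
    exact ⟨(⟨q, hq⟩, ⟨r, hr⟩), Subtype.ext hz⟩
  -- Linearity of the right inverse makes the norms of both parts quadratic forms in the field,
  -- hence bounded by its L²-norm.
  obtain ⟨G, hG⟩ := Φ.exists_rightInverse_of_surjective hΦ
  refine ⟨G, fun z => ?_⟩
  have := congrArg Subtype.val (LinearMap.congr_fun hG z)
  exact this

theorem intElem_C_mul {T : Set Plane} (hT : Bornology.IsBounded T) (c : ℝ) (p : Poly) :
    intElem T (MvPolynomial.C c * p) = c * intElem T p := by
  rw [MvPolynomial.C_mul', intElem_smul hT]

theorem ComparableToDisk.intElem_one_pos {ρ h : ℝ} (hρ : 0 < ρ) {T : Set Plane} {x₀ : Plane}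
    (H : ComparableToDisk ρ T x₀ h) : 0 < intElem T 1 := by
  rcases (intElem_mul_self_nonneg T 1).lt_or_eq with h1 | h1
  · simpa using h1
  · exact absurd (eq_zero_of_intElem_mul_self H.isBounded (mul_pos hρ H.pos) H.ball_subset h1.symm)
      one_ne_zero

/-- Subtracting the mean value does not increase the `L²`-norm. -/
theorem ComparableToDisk.exists_sub_mean {ρ h : ℝ} (hρ : 0 < ρ) {T : Set Plane} {x₀ : Plane}
    (H : ComparableToDisk ρ T x₀ h) (q : Poly) :
    ∃ c : ℝ, intElem T (q - MvPolynomial.C c) = 0 ∧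
      intElem T ((q - MvPolynomial.C c) * (q - MvPolynomial.C c)) ≤ intElem T (q * q) := by
  have h1 := H.intElem_one_pos hρ
  have hsub : ∀ p r, intElem T (p - r) = intElem T p - intElem T r :=
    (intElemₗ H.isBounded).map_sub
  have hadd : ∀ p r, intElem T (p + r) = intElem T p + intElem T r :=
    (intElemₗ H.isBounded).map_add
  have hC : ∀ a, intElem T (MvPolynomial.C a) = a * intElem T 1 := fun a => by
    rw [← intElem_C_mul H.isBounded, mul_one]
  set c := intElem T q / intElem T 1 with hc
  have hq : intElem T q = c * intElem T 1 := by rw [hc]; field_simp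
  refine ⟨c, by rw [hsub, hC, hq, sub_self], ?_⟩
  have e : (q - MvPolynomial.C c) * (q - MvPolynomial.C c)
      = q * q - MvPolynomial.C (2 * c) * q + MvPolynomial.C (c * c) := by
    simp only [map_mul, map_ofNat]; ring
  rw [e, hadd, hsub, intElem_C_mul H.isBounded, hC, hq]
  nlinarith [mul_nonneg (mul_self_nonneg c) h1.le]

/-- The decomposition `P^k(T)² = VROT P^{k+1}(T) + (x - x_T) P^{k-1}(T)` is stable. -/
theorem exists_stable_decomposition {ρ : ℝ} (hρ : 0 < ρ) (k : ℕ) :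
    ∃ C : ℝ, 0 < C ∧ ∀ T x₀ h, ComparableToDisk ρ T x₀ h → ∀ z ∈ vecPolySpace k,
      ∃ q ∈ polySpace ((k : ℤ) + 1), ∃ w ∈ crolySpace k x₀, intElem T q = 0 ∧ vrot q + w = z ∧
        intElem T (q * q) ≤ C * (h ^ 2 * intElem T (dot z z)) ∧
        intElem T (dot w w) ≤ C * intElem T (dot z z) := by
  obtain ⟨G, hG⟩ := exists_decomposition k
  obtain ⟨C₁, hC₁, h₁⟩ := exists_evalAt_sq_le_intElem hρ ((k : ℤ) + 1)
  obtain ⟨C₂, hC₂, h₂⟩ := exists_intElem_dot_le hρ k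
  obtain ⟨C₃, hC₃, h₃⟩ := exists_form_le_vec hρ k
    ((elemForm (T := Metric.ball 0 ρ) Metric.isBounded_ball).compl₁₂
      ((polySpace ((k : ℤ) + 1)).subtype ∘ₗ LinearMap.fst ℝ _ _ ∘ₗ G)
      ((polySpace ((k : ℤ) + 1)).subtype ∘ₗ LinearMap.fst ℝ _ _ ∘ₗ G))
  obtain ⟨C₄, hC₄, h₄⟩ := exists_form_le_vec hρ k
    ((vecForm (T := Metric.ball 0 ρ) Metric.isBounded_ball).compl₁₂
      (koszul 0 ∘ₗ (polySpace ((k : ℤ) - 1)).subtype ∘ₗ LinearMap.snd ℝ _ _ ∘ₗ G)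
      (koszul 0 ∘ₗ (polySpace ((k : ℤ) - 1)).subtype ∘ₗ LinearMap.snd ℝ _ _ ∘ₗ G))
  refine ⟨C₁ * C₃ + C₂ * C₄, by positivity, fun T x₀ h H z hz => ?_⟩
  have hh := H.pos
  set z' : vecPolySpace k := ⟨affineSubstVec x₀ h z, affineSubstVec_mem hz⟩ with hz'
  have e₃ := h₃ z'
  have e₄ := h₄ z'
  have e₅ := H.scaled_intElem_dot_le z
  have eG := hG z'
  simp only [LinearMap.compl₁₂_apply, LinearMap.comp_apply, Submodule.subtype_apply,
    vecForm_apply, elemForm_apply, LinearMap.fst_apply, LinearMap.snd_apply] at e₃ e₄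
  set q' : Poly := (G z').1.1 with hq'
  set r' : Poly := (G z').2.1 with hr'
  set B := intElem (Metric.ball 0 ρ) (dot (z' : VecPoly) z') with hB
  have hz0 := intElem_dot_self_nonneg T z
  -- The weights h and h⁻¹ undo the factors that the rotor and the Koszul map pick up under
  -- rescaling; the weight on q₀ yields the h² in its bound.
  set q₀ : Poly := h • affineSubst (-h⁻¹ • x₀) h⁻¹ q' with hq₀
  set r : Poly := h⁻¹ • affineSubst (-h⁻¹ • x₀) h⁻¹ r' with hr
  have hSq : affineSubst x₀ h q₀ = h • q' := by
    rw [hq₀, map_smul, affineSubst_affineSubst_inv x₀ hh.ne']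
  have hSr : affineSubst x₀ h r = h⁻¹ • r' := by
    rw [hr, map_smul, affineSubst_affineSubst_inv x₀ hh.ne']
  have hq₀mem : q₀ ∈ polySpace ((k : ℤ) + 1) :=
    Submodule.smul_mem _ _ (affineSubst_mem_polySpace _ _ (G z').1.2)
  have hrmem : r ∈ polySpace ((k : ℤ) - 1) :=
    Submodule.smul_mem _ _ (affineSubst_mem_polySpace _ _ (G z').2.2)
  have hSw : affineSubstVec x₀ h (koszul x₀ r) = koszul 0 r' := by
    rw [affineSubstVec_koszul, hSr, map_smul, smul_smul, mul_inv_cancel₀ hh.ne', one_smul]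
  have hdec : vrot q₀ + koszul x₀ r = z := by
    apply affineSubstVec_injective x₀ hh.ne'
    rw [affineSubstVec_add, affineSubstVec_vrot x₀ hh.ne', hSq, hSw, map_smul, smul_smul,
      inv_mul_cancel₀ hh.ne', one_smul, eG]
  -- Removing the mean leaves the rotor unchanged and does not increase the norm.
  obtain ⟨c, hc0, hcle⟩ := H.exists_sub_mean hρ q₀
  refine ⟨q₀ - MvPolynomial.C c, Submodule.sub_mem _ hq₀mem (C_mem_polySpace (by positivity) c),
    koszul x₀ r, Submodule.mem_map_of_mem hrmem, hc0, ?_, ?_, ?_⟩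
  · rw [map_sub, vrot_C, sub_zero, hdec]
  · have e₁ := (h₁ T x₀ h H q₀ hq₀mem).2
    rw [hSq, smul_mul_smul_comm h q', intElem_smul Metric.isBounded_ball] at e₁
    calc _ ≤ intElem T (q₀ * q₀) := hcle
      _ ≤ C₁ * (h ^ 2 * (h * h * (C₃ * B))) := e₁.trans (by gcongr)
      _ = C₁ * C₃ * (h ^ 2 * (h ^ 2 * B)) := by ring
      _ ≤ C₁ * C₃ * (h ^ 2 * intElem T (dot z z)) := by gcongr
      _ ≤ _ := by gcongr; nlinarith
  · have e₂ := h₂ T x₀ h H _ (koszul_mem_vecPolySpace x₀ hrmem)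
    rw [hSw] at e₂
    calc _ ≤ C₂ * (h ^ 2 * (C₄ * B)) := e₂.trans (by gcongr)
      _ = C₂ * C₄ * (h ^ 2 * B) := by ring
      _ ≤ C₂ * C₄ * intElem T (dot z z) := by gcongr
      _ ≤ _ := by gcongr; nlinarith

end VectorEstimates

/-! ### Integrals over edges -/

section EdgeIntegrals

variable (E : Edge)

theorem Edge.length_pos : 0 < E.length := dist_pos.2 E.ne

/-- The integral over an edge as a linear form. -/
noncomputable def intEdgeₗ : ℝ[X] →ₗ[ℝ] ℝ where
  toFun := intEdge E
  map_add' p q := by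
    simp only [intEdge, eval_add]
    rw [intervalIntegral.integral_add (p.continuous.intervalIntegrable _ _)
      (q.continuous.intervalIntegrable _ _), mul_add]
  map_smul' c p := by
    simp only [intEdge, eval_smul, smul_eq_mul, intervalIntegral.integral_const_mul,
      RingHom.id_apply]
    ring

/-- The `L²`-product on an edge. -/
noncomputable def edgeForm : ℝ[X] →ₗ[ℝ] ℝ[X] →ₗ[ℝ] ℝ :=
  (LinearMap.mul ℝ ℝ[X]).compr₂ (intEdgeₗ E)

@[simp]
theorem edgeForm_apply (p q : ℝ[X]) : edgeForm E p q = intEdge E (p * q) := rfl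

theorem intEdge_add (p q : ℝ[X]) : intEdge E (p + q) = intEdge E p + intEdge E q :=
  (intEdgeₗ E).map_add p q

theorem intEdge_smul (c : ℝ) (p : ℝ[X]) : intEdge E (c • p) = c * intEdge E p :=
  (intEdgeₗ E).map_smul c p

theorem intEdge_sub (p q : ℝ[X]) : intEdge E (p - q) = intEdge E p - intEdge E q :=
  (intEdgeₗ E).map_sub p q

theorem intEdge_mono {p q : ℝ[X]} (h : ∀ s ∈ Set.Icc (0 : ℝ) 1, p.eval s ≤ q.eval s) :
    intEdge E p ≤ intEdge E q :=
  mul_le_mul_of_nonneg_left (intervalIntegral.integral_mono_on zero_le_one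
    (p.continuous.intervalIntegrable _ _) (q.continuous.intervalIntegrable _ _) h)
    E.length_pos.le

theorem intEdge_C (c : ℝ) : intEdge E (C c) = E.length * c := by
  simp [intEdge]

theorem intEdge_sq_nonneg (p : ℝ[X]) : 0 ≤ intEdge E (p ^ 2) :=
  mul_nonneg E.length_pos.le (intervalIntegral.integral_nonneg zero_le_one fun s _ => by
    rw [eval_pow]; positivity)

theorem intEdge_mul_self_nonneg (p : ℝ[X]) : 0 ≤ intEdge E (p * p) := by
  rw [← sq]; exact intEdge_sq_nonneg E p

theorem intEdge_mul_sq_le (p q : ℝ[X]) :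
    intEdge E (p * q) ^ 2 ≤ intEdge E (p ^ 2) * intEdge E (q ^ 2) := by
  rw [sq p, sq q]
  exact form_sq_le (B := edgeForm E) (intEdge_mul_self_nonneg E)
    (fun p q => by simp [mul_comm]) p q

theorem intEdge_add_sq_le (p q : ℝ[X]) :
    intEdge E ((p + q) ^ 2) ≤ 2 * intEdge E (p ^ 2) + 2 * intEdge E (q ^ 2) := by
  have := intEdge_mono E (p := (p + q) ^ 2) (q := (2 : ℝ) • p ^ 2 + (2 : ℝ) • q ^ 2) fun s _ => by
    simp only [eval_pow, eval_add, eval_smul, smul_eq_mul]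
    nlinarith [sq_nonneg (p.eval s - q.eval s)]
  rwa [intEdge_add, intEdge_smul, intEdge_smul] at this

theorem eq_zero_of_intEdge_mul_self {p : ℝ[X]} (hp : intEdge E (p * p) = 0) : p = 0 := by
  have h0 : ∫ s in (0 : ℝ)..1, (p * p).eval s = 0 :=
    (mul_eq_zero.1 hp).resolve_left E.length_pos.ne'
  have hnn : ∀ s, 0 ≤ (p * p).eval s := fun s => by
    rw [eval_mul]; exact mul_self_nonneg _
  rw [intervalIntegral.integral_of_le zero_le_one, integral_Ioc_eq_integral_Ioo,
    setIntegral_eq_zero_iff_of_nonneg_ae (Filter.Eventually.of_forall hnn)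
      (((p * p).continuous.continuousOn.integrableOn_compact isCompact_Icc).mono_set
        Set.Ioo_subset_Icc_self)] at h0
  have h2 := Measure.eqOn_open_of_ae_eq h0 isOpen_Ioo (p * p).continuous.continuousOn
    continuousOn_const
  refine eq_zero_of_infinite_isRoot p ((Set.Ioo_infinite (zero_lt_one' ℝ)).mono fun s hs => ?_)
  have := h2 hs
  simpa using this

theorem eval_traceEdge (p : Poly) (s : ℝ) :
    (traceEdge E p).eval s = evalAt (E.src + s • (E.tgt - E.src)) p := by
  induction p using MvPolynomial.induction_on with
  | C a => simp [traceEdge, evalAt]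
  | add p q hp hq => simp only [evalAt, map_add, eval_add] at *; rw [hp, hq]
  | mul_X p j hp =>
    simp only [evalAt, map_mul, eval_mul] at *
    rw [hp]
    simp [traceEdge, mul_comm]

theorem Edge.abs_tangent_le (i : Fin 2) : |E.tangent i| ≤ 1 := by
  refine (PiLp.norm_apply_le E.tangent i).trans ?_
  rw [Edge.tangent, norm_smul, norm_inv, Real.norm_of_nonneg E.length_pos.le, Edge.length,
    dist_comm, dist_eq_norm, inv_mul_cancel₀]
  rw [← dist_eq_norm]
  exact (dist_pos.2 E.ne.symm).ne'

/-- The edges with endpoints in the closed disk of centre `x₀` and radius `h`. -/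
def Edge.IsIn (x₀ : Plane) (h : ℝ) : Prop :=
  E.src ∈ Metric.closedBall x₀ h ∧ E.tgt ∈ Metric.closedBall x₀ h

/-- The discrete trace inequality. -/
theorem exists_intEdge_trace_le {ρ : ℝ} (hρ : 0 < ρ) (m : ℤ) :
    ∃ C : ℝ, 0 < C ∧ ∀ T x₀ h, ComparableToDisk ρ T x₀ h → ∀ E : Edge, E.IsIn x₀ h →
      (∀ p ∈ polySpace m, h * intEdge E (traceEdge E p ^ 2) ≤ C * intElem T (p * p)) ∧
      (∀ v ∈ vecPolySpace m,
        h * intEdge E (tangentialTrace E v ^ 2) ≤ C * intElem T (dot v v)) := by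
  obtain ⟨C, hC, hle⟩ := exists_evalAt_sq_le_intElem hρ m
  have key : ∀ T x₀ h, ComparableToDisk ρ T x₀ h → ∀ E : Edge, E.IsIn x₀ h →
      ∀ p ∈ polySpace m, h * intEdge E (traceEdge E p ^ 2) ≤ 2 * C * intElem T (p * p) := by
    intro T x₀ h H E hE p hp
    have hh := H.pos
    -- The edge lies in the large disk by convexity, so the pointwise inverse inequality holds along
    -- it; integration then costs only the length, at most 2h.
    have hpt : ∀ s ∈ Set.Icc (0 : ℝ) 1, (traceEdge E p ^ 2).eval s
        ≤ (Polynomial.C ((h ^ 2)⁻¹ * (C * intElem T (p * p)))).eval s := fun s hs => by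
      rw [eval_pow, eval_traceEdge, eval_C, ← div_eq_inv_mul, le_div_iff₀' (by positivity)]
      refine (hle T x₀ h H p hp).1 _ ((convex_closedBall x₀ h).segment_subset hE.1 hE.2 ?_)
      rw [segment_eq_image']
      exact ⟨s, hs, rfl⟩
    have hlen : E.length ≤ 2 * h := by
      have := dist_triangle_right E.src E.tgt x₀
      have h1 := Metric.mem_closedBall.1 hE.1
      have h2 := Metric.mem_closedBall.1 hE.2
      rw [Edge.length]; linarith
    have hn := intElem_mul_self_nonneg T p
    calc h * intEdge E (traceEdge E p ^ 2)
        ≤ h * (E.length * ((h ^ 2)⁻¹ * (C * intElem T (p * p)))) := by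
          rw [← intEdge_C]; gcongr; exact intEdge_mono E hpt
      _ ≤ h * (2 * h * ((h ^ 2)⁻¹ * (C * intElem T (p * p)))) := by gcongr
      _ = 2 * C * intElem T (p * p) := by field_simp
  -- One factor 2 comes from the length of the edge, the other from squaring the sum of the two
  -- tangential contributions.
  refine ⟨4 * C, by positivity, fun T x₀ h H E hE => ⟨fun p hp => ?_, fun v hv => ?_⟩⟩
  · have := mul_nonneg hC.le (intElem_mul_self_nonneg T p)
    linarith [key T x₀ h H E hE p hp]
  · rw [mem_vecPolySpace] at hv
    have h0 := key T x₀ h H E hE _ (hv 0)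
    have h1 := key T x₀ h H E hE _ (hv 1)
    have ht : ∀ i, intEdge E ((Polynomial.C (E.tangent i) * traceEdge E (v i)) ^ 2)
        ≤ intEdge E (traceEdge E (v i) ^ 2) := fun i => intEdge_mono E fun s _ => by
      rw [eval_pow, eval_pow, eval_mul, eval_C, mul_pow]
      exact mul_le_of_le_one_left (sq_nonneg _)
        ((sq_le_one_iff_abs_le_one _).2 (E.abs_tangent_le i))
    have hs := intEdge_add_sq_le E (Polynomial.C (E.tangent 0) * traceEdge E (v 0))
      (Polynomial.C (E.tangent 1) * traceEdge E (v 1))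
    have hh := H.pos
    rw [intElem_dot H.isBounded]
    calc h * intEdge E (tangentialTrace E v ^ 2)
        ≤ h * (2 * intEdge E (traceEdge E (v 0) ^ 2) + 2 * intEdge E (traceEdge E (v 1) ^ 2)) := by
          gcongr
          exact hs.trans (by gcongr <;> exact ht _)
      _ ≤ _ := by linarith

end EdgeIntegrals

end RotRot

namespace RotRot

open MeasureTheory

/-! ### Geometry of regular meshes -/

section Geometry

theorem isBounded_of_isPolygonal {A : Set Plane} (hA : IsPolygonal A) : Bornology.IsBounded A := by
  obtain ⟨_, F, _, rfl⟩ := hA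
  refine Bornology.IsBounded.subset ?_ interior_subset
  rw [Bornology.isBounded_biUnion_finset]
  exact fun p _ => isBounded_convexHull.2 (Set.finite_range p).isBounded

theorem isOpen_of_isPolygonal {A : Set Plane} (hA : IsPolygonal A) : IsOpen A := by
  obtain ⟨_, F, _, rfl⟩ := hA
  exact isOpen_interior

theorem diam_pos_of_isPolygonal {A : Set Plane} (hA : IsPolygonal A) : 0 < Metric.diam A := by
  obtain ⟨x, hx⟩ := hA.1.nonempty
  exact Metric.diam_pos
    (infinite_of_mem_nhds x ((isOpen_of_isPolygonal hA).mem_nhds hx)).nontrivial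
    (isBounded_of_isPolygonal hA)

variable {Ω : Set Plane} {M : PolygonalMesh Ω} {ρ : ℝ}

theorem PolygonalMesh.IsRegular.comparableToDisk (hM : M.IsRegular ρ) (hρ : 0 < ρ) {T : Set Plane}
    (hT : T ∈ M.elements) : ComparableToDisk ρ T (M.center T) (Metric.diam T) := by
  have hd := diam_pos_of_isPolygonal (M.isPolygonal T hT)
  have hb := hM.2 T hT
  refine ⟨hd, isOpen_of_isPolygonal (M.isPolygonal T hT), hb, fun x hx => ?_⟩
  exact Metric.dist_le_diam_of_mem (isBounded_of_isPolygonal (M.isPolygonal T hT)) hx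
    (hb (Metric.mem_ball_self (by positivity)))

theorem PolygonalMesh.edge_subset_frontier {T : Set Plane} {E : Edge} (hE : E ∈ M.edgesOf T) :
    E.carrier ⊆ frontier T := by
  classical
  exact (Finset.mem_filter.1 hE).2

theorem ComparableToDisk.edge_isIn {T : Set Plane} {x₀ : Plane} {h : ℝ}
    (H : ComparableToDisk ρ T x₀ h) {E : Edge} (hE : E.carrier ⊆ frontier T) : E.IsIn x₀ h := by
  have h1 : segment ℝ E.src E.tgt ⊆ Metric.closedBall x₀ h := by
    rw [← closure_openSegment]
    exact closure_minimal ((hE.trans frontier_subset_closure).trans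
      (closure_minimal H.subset_closedBall Metric.isClosed_closedBall)) Metric.isClosed_closedBall
  exact ⟨h1 (left_mem_segment ℝ _ _), h1 (right_mem_segment ℝ _ _)⟩

/-! ### Triangles of the submesh and the number of edges -/

theorem interior_convexHull_eq_empty_of_card_le {t : Finset Plane} (ht : t.card ≤ 2) :
    interior (convexHull ℝ (t : Set Plane)) = ∅ := by
  classical
  rw [← Set.not_nonempty_iff_eq_empty, interior_convexHull_nonempty_iff_affineSpan_eq_top]
  intro h
  have h2 : Module.finrank ℝ (vectorSpan ℝ (t : Set Plane)) = 2 := by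
    rw [← direction_affineSpan, h, AffineSubspace.direction_top, finrank_top,
      finrank_euclideanSpace_fin]
  have hne : t.card ≠ 0 := fun h0 => by
    rw [Finset.card_eq_zero.1 h0, Finset.coe_empty, vectorSpan_empty, finrank_bot] at h2
    omega
  have h3 := finrank_vectorSpan_image_finset_le ℝ (id : Plane → Plane) t (n := t.card - 1)
    (by omega)
  rw [Finset.image_id] at h3
  omega

variable {K : Geometry.SimplicialComplex ℝ Plane}

/-- Distinct triangles share at most two vertices, and in a simplicial complex they meet inside the
hull of those, which has empty interior. -/
theorem disjoint_interior_of_card_eq_three {s t : Finset Plane} (hs : s ∈ K.faces)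
    (ht : t ∈ K.faces) (hs3 : s.card = 3) (ht3 : t.card = 3) (hst : s ≠ t) :
    Disjoint (interior (convexHull ℝ (s : Set Plane))) (interior (convexHull ℝ (t : Set Plane))) := by
  classical
  have hcard : (s ∩ t).card ≤ 2 := by
    by_contra! h
    have h1 : s ∩ t = s := Finset.eq_of_subset_of_card_le Finset.inter_subset_left (by omega)
    have h2 : s ∩ t = t := Finset.eq_of_subset_of_card_le Finset.inter_subset_right (by omega)
    exact hst (h1.symm.trans h2)
  rw [Set.disjoint_iff, ← interior_inter, ← interior_convexHull_eq_empty_of_card_le hcard,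
    Finset.coe_inter]
  exact interior_mono (K.inter_subset_convexHull hs ht)

/-- A point of a triangle which is neither interior nor a vertex lies on an open side. -/
theorem exists_mem_openSegment_of_notMem_interior {s : Finset Plane}
    (hs : AffineIndependent ℝ ((↑) : s → Plane)) (hs3 : s.card = 3) {x : Plane}
    (hx : x ∈ convexHull ℝ (s : Set Plane)) (hxi : x ∉ interior (convexHull ℝ (s : Set Plane)))
    (hxv : x ∉ s) : ∃ a ∈ s, ∃ b ∈ s, a ≠ b ∧ x ∈ openSegment ℝ a b := by
  classical
  obtain ⟨w, hw0, hw1, hwx⟩ := Finset.mem_convexHull'.1 hx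
  -- If all barycentric coordinates were positive, x would be interior. Dropping a vertex with zero
  -- weight puts x on the opposite side.
  have hzero : ∃ y ∈ s, w y = 0 := by
    by_contra! hne
    apply hxi
    let b : AffineBasis s ℝ Plane := ⟨_, hs, by
      rw [hs.affineSpan_eq_top_iff_card_eq_finrank_add_one, finrank_euclideanSpace_fin]
      simpa using hs3⟩
    have hb : Set.range b = (s : Set Plane) := Subtype.range_coe
    rw [← hb, AffineBasis.interior_convexHull]
    intro i
    have hsum : ∑ j : s, w j = 1 := by rw [← hw1]; exact Finset.sum_coe_sort s w
    have hcomb : Finset.univ.affineCombination ℝ b (fun j : s => w j) = x := by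
      rw [Finset.affineCombination_eq_linear_combination _ _ _ hsum, ← hwx]
      exact Finset.sum_coe_sort s fun y => w y • y
    rw [← hcomb, b.coord_apply_combination_of_mem (Finset.mem_univ i) hsum]
    exact lt_of_le_of_ne (hw0 i i.2) (hne i i.2).symm
  obtain ⟨y, hy, hwy⟩ := hzero
  have hx' : x ∈ convexHull ℝ ((s.erase y : Finset Plane) : Set Plane) :=
    Finset.mem_convexHull'.2 ⟨w, fun z hz => hw0 z (Finset.mem_of_mem_erase hz),
      by rw [Finset.sum_erase _ hwy, hw1],
      by rw [Finset.sum_erase _ (by rw [hwy, zero_smul]), hwx]⟩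
  obtain ⟨a, b, hab, he⟩ := Finset.card_eq_two.1
    (show (s.erase y).card = 2 by rw [Finset.card_erase_of_mem hy, hs3])
  have ha : a ∈ s := Finset.mem_of_mem_erase (show a ∈ s.erase y by simp [he])
  have hb : b ∈ s := Finset.mem_of_mem_erase (show b ∈ s.erase y by simp [he])
  rw [he, Finset.coe_pair, convexHull_pair] at hx'
  exact ⟨a, ha, b, hb, hab, mem_openSegment_of_ne_left_right (fun h => hxv (h ▸ ha))
    (fun h => hxv (h ▸ hb)) hx'⟩

open Classical in
/-- The triangles of the submesh contained in an element. -/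
noncomputable def trianglesIn (hK : K.faces.Finite) (T : Set Plane) : Finset (Finset Plane) :=
  hK.toFinset.filter fun s => s.card = 3 ∧ interior (convexHull ℝ (s : Set Plane)) ⊆ T

theorem mem_trianglesIn {hK : K.faces.Finite} {T : Set Plane} {s : Finset Plane} :
    s ∈ trianglesIn hK T ↔
      s ∈ K.faces ∧ s.card = 3 ∧ interior (convexHull ℝ (s : Set Plane)) ⊆ T := by
  classical
  simp [trianglesIn]

theorem PolygonalMesh.element_subset_closure {T : Set Plane} (hT : T ∈ M.elements) : T ⊆ closure Ω := by
  rw [M.closure_eq]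
  exact subset_closure.trans (Set.subset_biUnion_of_mem (u := fun T => closure T) hT)

/-- An element is covered by the closed triangles it contains. -/
theorem PolygonalMesh.IsRegularSubmesh.closure_subset (hK : M.IsRegularSubmesh ρ K) {T : Set Plane}
    (hT : T ∈ M.elements) :
    closure T ⊆ ⋃ s ∈ trianglesIn hK.finite T, convexHull ℝ (s : Set Plane) := by
  set U := ⋃ s ∈ trianglesIn hK.finite T, convexHull ℝ (s : Set Plane) with hU
  have hUc : IsClosed U := isClosed_biUnion_finset fun s _ =>
    (s.finite_toSet.isCompact_convexHull ℝ).isClosed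
  refine closure_minimal ?_ hUc
  by_contra hsub
  obtain ⟨x, hxT, hxU⟩ := Set.not_subset.1 hsub
  have hO : IsOpen (T \ U) := (isOpen_of_isPolygonal (M.isPolygonal T hT)).sdiff hUc
  -- An uncovered point of T cannot be interior to a triangle: that triangle would lie in T by
  -- disjointness of the elements. So it lies on one of finitely many null frontiers, whereas a
  -- nonempty open set has positive measure.
  have hcov : T \ U ⊆ ⋃ s ∈ hK.finite.toFinset, frontier (convexHull ℝ (s : Set Plane)) := by
    intro y hy
    have hyK : y ∈ K.space := hK.space_eq ▸ M.element_subset_closure hT hy.1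
    obtain ⟨s, hs, hys⟩ := K.mem_space_iff.1 hyK
    obtain ⟨t, ht, hst, ht3⟩ := hK.pure s hs
    have hyt : y ∈ convexHull ℝ (t : Set Plane) := convexHull_mono (by exact_mod_cast hst) hys
    refine Set.mem_biUnion (x := t) (by simpa using ht) ⟨subset_closure hyt, fun hyi => ?_⟩
    obtain ⟨T', ⟨hT', hsubT'⟩, _⟩ := hK.element t ht ht3
    have hTT' : T = T' := by
      by_contra hne
      exact Set.disjoint_left.1 (M.elements_disjoint T hT T' hT' hne) hy.1 (hsubT' hyi)
    subst hTT'
    exact hy.2 (Set.mem_biUnion (x := t) (mem_trianglesIn.2 ⟨ht, ht3, hsubT'⟩) hyt)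
  have hnull : volume (T \ U) = 0 :=
    measure_mono_null hcov ((measure_biUnion_null_iff (Finset.countable_toSet _)).2 fun s _ =>
      (convex_convexHull ℝ _).addHaar_frontier volume)
  exact (hO.measure_pos volume ⟨x, hxT, hxU⟩).ne' hnull

/-- Area count: by shape and contact regularity each triangle in T contains a disk of radius ρ²h.
These disks are disjoint and lie in a disk of radius h. -/
theorem PolygonalMesh.IsRegularSubmesh.card_trianglesIn_mul_le (hK : M.IsRegularSubmesh ρ K)
    (hρ : 0 < ρ) {T : Set Plane} (hT : T ∈ M.elements) {x₀ : Plane}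
    (H : ComparableToDisk ρ T x₀ (Metric.diam T)) :
    (trianglesIn hK.finite T).card * ρ ^ 4 ≤ 1 := by
  have hh := H.pos
  set h := Metric.diam T
  set ω : ℝ := volume.real (Metric.ball (0 : Plane) 1) with hω
  have hω0 : 0 < ω := ENNReal.toReal_pos (Metric.measure_ball_pos _ _ one_pos).ne'
    measure_ball_lt_top.ne
  have hball : ∀ s ∈ trianglesIn hK.finite T, ∃ x : Plane,
      Metric.ball x (ρ * (ρ * h)) ⊆ interior (convexHull ℝ (s : Set Plane)) := fun s hs => by
    obtain ⟨hsK, hs3, hsT⟩ := mem_trianglesIn.1 hs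
    obtain ⟨x, hx⟩ := hK.shape s hsK hs3
    refine ⟨x, interior_maximal (subset_trans ?_ hx) Metric.isOpen_ball⟩
    refine Metric.ball_subset_closedBall.trans (Metric.closedBall_subset_closedBall ?_)
    exact mul_le_mul_of_nonneg_left (hK.contact s hsK hs3 T hT hsT) hρ.le
  choose! c hc using hball
  have hdisj : (trianglesIn hK.finite T : Set (Finset Plane)).PairwiseDisjoint
      fun s => Metric.ball (c s) (ρ * (ρ * h)) := fun s hs t ht hst =>
    Disjoint.mono (hc s hs) (hc t ht) (disjoint_interior_of_card_eq_three
      (mem_trianglesIn.1 hs).1 (mem_trianglesIn.1 ht).1 (mem_trianglesIn.1 hs).2.1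
      (mem_trianglesIn.1 ht).2.1 hst)
  have hvolball : ∀ x, volume.real (Metric.ball (x : Plane) (ρ * (ρ * h)))
      = (ρ * (ρ * h)) ^ 2 * ω := fun x => by
    rw [Measure.real, Measure.addHaar_ball volume x (by positivity), ENNReal.toReal_mul,
      finrank_euclideanSpace_fin, ENNReal.toReal_ofReal (by positivity)]
    rfl
  have hvol : volume.real (Metric.closedBall x₀ h) = h ^ 2 * ω := by
    rw [Measure.real, Measure.addHaar_closedBall volume x₀ hh.le, ENNReal.toReal_mul,
      finrank_euclideanSpace_fin, ENNReal.toReal_ofReal (by positivity)]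
    rfl
  have hsum := measureReal_biUnion_finset (μ := volume) hdisj (fun _ _ => measurableSet_ball)
    (fun _ _ => measure_ball_lt_top.ne)
  simp only [hvolball, Finset.sum_const, nsmul_eq_mul] at hsum
  have hle : (trianglesIn hK.finite T).card * ((ρ * (ρ * h)) ^ 2 * ω) ≤ h ^ 2 * ω := by
    rw [← hsum, ← hvol]
    refine measureReal_mono (Set.iUnion₂_subset fun s hs => ?_) measure_closedBall_lt_top.ne
    exact ((hc s hs).trans (mem_trianglesIn.1 hs).2.2).trans H.subset_closedBall
  have : ((trianglesIn hK.finite T).card * ρ ^ 4) * (h ^ 2 * ω) ≤ 1 * (h ^ 2 * ω) := by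
    calc _ = (trianglesIn hK.finite T).card * ((ρ * (ρ * h)) ^ 2 * ω) := by ring
      _ ≤ _ := by rw [one_mul]; exact hle
  exact le_of_mul_le_mul_right this (by positivity)

/-- Every edge of an element contains an open side of a triangle of this element. -/
theorem PolygonalMesh.IsRegularSubmesh.exists_side (hK : M.IsRegularSubmesh ρ K) {T : Set Plane}
    (hT : T ∈ M.elements) {E : Edge} (hE : E ∈ M.edgesOf T) :
    ∃ s ∈ trianglesIn hK.finite T, ∃ a ∈ s, ∃ b ∈ s, a ≠ b ∧ openSegment ℝ a b ⊆ E.carrier := by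
  classical
  have hfr := M.edge_subset_frontier hE
  have hinf : E.carrier.Infinite := by
    rw [Edge.carrier, openSegment_eq_image_lineMap]
    exact (Set.Ioo_infinite zero_lt_one).image (AffineMap.lineMap_injective ℝ E.ne).injOn
  -- A point of E that is no vertex of the submesh lies in a triangle of T, but not in its interior
  -- since it is on the frontier of T. Hence it lies on an open side, and a side that meets E is
  -- contained in E.
  obtain ⟨x, hxE, hxv⟩ := hinf.exists_notMem_finset (hK.finite.toFinset.biUnion id)
  have hxT := hfr hxE
  obtain ⟨s, hs, hxs⟩ := Set.mem_iUnion₂.1 (hK.closure_subset hT hxT.1)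
  obtain ⟨hsK, hs3, hsT⟩ := mem_trianglesIn.1 hs
  have hxi : x ∉ interior (convexHull ℝ (s : Set Plane)) := fun h =>
    hxT.2 ((isOpen_of_isPolygonal (M.isPolygonal T hT)).interior_eq.symm ▸ hsT h)
  have hxs' : x ∉ s := fun h =>
    hxv (Finset.mem_biUnion.2 ⟨s, by simpa using hsK, h⟩)
  obtain ⟨a, ha, b, hb, hab, hxab⟩ :=
    exists_mem_openSegment_of_notMem_interior (K.indep hsK) hs3 hxs hxi hxs'
  refine ⟨s, hs, a, ha, b, hb, hab, ?_⟩
  have hface : ({a, b} : Finset Plane) ∈ K.faces :=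
    K.down_closed hsK (by simp [Finset.insert_subset_iff, ha, hb]) (Finset.insert_nonempty _ _)
  refine (hK.edge a b hab ?_ E (PolygonalMesh.mem_edges_of_mem_edgesOf hE)).resolve_left
    fun h => Set.disjoint_left.1 h hxab hxE
  convert hface

/-- Choosing a side inside each edge is injective because distinct edges are disjoint, and each
triangle offers three sides. -/
theorem PolygonalMesh.IsRegularSubmesh.card_edgesOf_le (hK : M.IsRegularSubmesh ρ K)
    {T : Set Plane} (hT : T ∈ M.elements) :
    (M.edgesOf T).card ≤ (trianglesIn hK.finite T).card * 3 := by
  classical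
  have h1 : ∀ E ∈ M.edgesOf T, ∃ e ∈ (trianglesIn hK.finite T).biUnion (Finset.powersetCard 2),
      ∃ a b, e = {a, b} ∧ openSegment ℝ a b ⊆ E.carrier := fun E hE => by
    obtain ⟨s, hs, a, ha, b, hb, hab, hsub⟩ := hK.exists_side hT hE
    refine ⟨{a, b}, Finset.mem_biUnion.2 ⟨s, hs, Finset.mem_powersetCard.2 ⟨?_, ?_⟩⟩,
      a, b, rfl, hsub⟩
    · simp [Finset.insert_subset_iff, ha, hb]
    · exact Finset.card_pair hab
  choose! f hf hseg using h1
  calc (M.edgesOf T).card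
      ≤ ((trianglesIn hK.finite T).biUnion (Finset.powersetCard 2)).card := by
        refine Finset.card_le_card_of_injOn f hf fun E hE E' hE' hEE' => ?_
        obtain ⟨a, b, he, hsub⟩ := hseg E hE
        obtain ⟨a', b', he', hsub'⟩ := hseg E' hE'
        have hpair : openSegment ℝ a b = openSegment ℝ a' b' := by
          have h2 : ({a, b} : Set Plane) = {a', b'} := by
            have h3 : ({a, b} : Finset Plane) = {a', b'} := by rw [← he, ← he', hEE']
            simpa using congrArg (fun e : Finset Plane => (e : Set Plane)) h3
          rcases Set.pair_eq_pair_iff.1 h2 with ⟨rfl, rfl⟩ | ⟨rfl, rfl⟩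
          · rfl
          · exact openSegment_symm ℝ _ _
        by_contra hne
        obtain ⟨x, hx⟩ : (openSegment ℝ a b).Nonempty := ⟨_, midpoint_mem_openSegment a b⟩
        exact Set.disjoint_left.1 (M.edges_disjoint E (mem_edges_of_mem_edgesOf hE) E'
          (mem_edges_of_mem_edgesOf hE') hne) (hsub hx) (hsub' (hpair ▸ hx))
    _ ≤ (trianglesIn hK.finite T).card * 3 :=
        Finset.card_biUnion_le_card_mul _ _ _ fun s hs => by
          rw [Finset.card_powersetCard, (mem_trianglesIn.1 hs).2.1]; rfl

theorem PolygonalMesh.card_verticesOf_le (M : PolygonalMesh Ω) (T : Set Plane) :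
    (M.verticesOf T).card ≤ (M.edgesOf T).card * 2 := by
  classical
  exact Finset.card_biUnion_le_card_mul _ _ _ fun E _ => Finset.card_le_two

/-- The number of edges of an element is bounded in terms of the regularity parameter. -/
theorem PolygonalMesh.IsRegular.card_edgesOf_mul_le (hM : M.IsRegular ρ) (hρ : 0 < ρ)
    {T : Set Plane} (hT : T ∈ M.elements) : (M.edgesOf T).card ≤ 3 * (ρ ^ 4)⁻¹ := by
  obtain ⟨K, hK⟩ := hM.1
  have h1 := hK.card_trianglesIn_mul_le hρ hT (hM.comparableToDisk hρ hT)
  have h2 : ((M.edgesOf T).card : ℝ) ≤ (trianglesIn hK.finite T).card * 3 := by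
    exact_mod_cast hK.card_edgesOf_le hT
  have h3 : ((trianglesIn hK.finite T).card : ℝ) ≤ (ρ ^ 4)⁻¹ := by
    rwa [← one_div, le_div_iff₀ (by positivity)]
  linarith

end Geometry

end RotRot

namespace RotRot

open MeasureTheory Polynomial

/-! ### Well-posedness of the local reconstructions -/

/-- Riesz representation supplies the polynomial that the choice in `edgeProj` refers to. -/
theorem edgeProj_spec (E : Edge) (m : ℤ) (f : ℝ[X]) : edgeProj E m f ∈ edgePolySpace E m ∧
    ∀ r ∈ edgePolySpace E m, intEdge E (edgeProj E m f * r) = intEdge E (f * r) := by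
  obtain ⟨g, hg, hgr⟩ := exists_represent (edgeForm E) (edgePolySpace E m)
    (fun p _ hp => eq_zero_of_intEdge_mul_self E hp)
    ((edgeForm E f).domRestrict (edgePolySpace E m))
  exact Classical.epsilon_spec (p := fun g => g ∈ edgePolySpace E m ∧
    ∀ r ∈ edgePolySpace E m, intEdge E (g * r) = intEdge E (f * r))
    ⟨g, hg, fun r hr => hgr ⟨r, hr⟩⟩

theorem intEdge_edgeProj_sq_le (E : Edge) (m : ℤ) (f : ℝ[X]) :
    intEdge E (edgeProj E m f ^ 2) ≤ intEdge E (f ^ 2) := by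
  obtain ⟨hg, hgr⟩ := edgeProj_spec E m f
  have h1 := hgr _ hg
  have h2 := intEdge_mul_sq_le E f (edgeProj E m f)
  rw [← h1, ← sq] at h2
  have h3 := intEdge_sq_nonneg E (edgeProj E m f)
  have h4 := intEdge_sq_nonneg E f
  nlinarith

/-- Testing the projection of f - c with c itself, which is allowed as c lies in the target space,
gives ‖c‖² = ∫ f c - ∫ π(f - c) c; Cauchy–Schwarz finishes. -/
theorem intEdge_sq_le_of_edgeProj_sub {E : Edge} {m : ℤ} (f : ℝ[X]) {c : ℝ[X]}
    (hc : c ∈ edgePolySpace E m) :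
    intEdge E (c ^ 2) ≤ 2 * intEdge E (f ^ 2) + 2 * intEdge E (edgeProj E m (f - c) ^ 2) := by
  have h1 := (edgeProj_spec E m (f - c)).2 c hc
  rw [sub_mul, intEdge_sub, ← sq] at h1
  have h2 := intEdge_mul_sq_le E f c
  have h3 := intEdge_mul_sq_le E (edgeProj E m (f - c)) c
  have h4 := intEdge_sq_nonneg E c
  have h5 := intEdge_sq_nonneg E f
  have h6 := intEdge_sq_nonneg E (edgeProj E m (f - c))
  rw [h1] at h3
  set A := intEdge E (f * c)
  set X := intEdge E (c ^ 2)
  set F := intEdge E (f ^ 2)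
  set G := intEdge E (edgeProj E m (f - c) ^ 2)
  rcases h4.eq_or_lt with h7 | h7
  · rw [← h7]; positivity
  · have : X * X ≤ (2 * F + 2 * G) * X := by nlinarith [sq_nonneg (A + (A - X))]
    exact le_of_mul_le_mul_right this h7

theorem orientation_sq (T : Set Plane) (E : Edge) : orientation T E ^ 2 = 1 := by
  unfold orientation
  split_ifs <;> norm_num

namespace SigmaT

variable {Ω : Set Plane} {M : PolygonalMesh Ω} {k : ℕ} {T : Set Plane} {ρ : ℝ}

/-- The boundary term `∑_E ω_{TE} ∫_E v_E q` as a linear form of `q`. -/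
noncomputable def boundary (v : SigmaT M k T) : Poly →ₗ[ℝ] ℝ :=
  ∑ E : M.edgesOf T, orientation T E.1 •
    (edgeForm E.1 (v.vE E : ℝ[X])) ∘ₗ (traceEdge E.1).toLinearMap

theorem boundary_apply (v : SigmaT M k T) (q : Poly) : v.boundary q =
    ∑ E : M.edgesOf T, orientation T E.1 * intEdge E.1 ((v.vE E : ℝ[X]) * traceEdge E.1 q) := by
  simp [boundary, LinearMap.sum_apply]

theorem rotor_spec (hρ : 0 < ρ) {x₀ : Plane} {h : ℝ} (H : ComparableToDisk ρ T x₀ h)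
    (v : SigmaT M k T) : v.rotor ∈ polySpace k ∧ ∀ q ∈ polySpace k,
      intElem T (v.rotor * q) = intElem T (dot (v.vR : VecPoly) (vrot q)) - v.boundary q := by
  obtain ⟨g, hg, hgr⟩ := exists_represent (elemForm H.isBounded) (polySpace k)
    (fun p _ hp => eq_zero_of_intElem_mul_self H.isBounded (mul_pos hρ H.pos) H.ball_subset hp)
    ((vecForm H.isBounded (v.vR : VecPoly) ∘ₗ vrot - v.boundary).domRestrict (polySpace k))
  simp only [boundary_apply]
  refine Classical.epsilon_spec (p := fun R => R ∈ polySpace k ∧ ∀ q ∈ polySpace k,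
    intElem T (R * q) = intElem T (dot (v.vR : VecPoly) (vrot q))
      - ∑ E : M.edgesOf T, orientation T E.1 * intEdge E.1 ((v.vE E : ℝ[X]) * traceEdge E.1 q))
    ⟨g, hg, fun q hq => ?_⟩
  rw [← boundary_apply]
  exact hgr ⟨q, hq⟩

/-- The map (q, w) ↦ rot q + w, from mean-free q and Koszul w, is bijective onto P^k(T)²: injective
since its kernel forces q to be constant, surjective by the decomposition. The right-hand side is
therefore a linear form on P^k(T)², and Riesz representation applies. -/
theorem potential_spec (hρ : 0 < ρ) {h : ℝ} (H : ComparableToDisk ρ T (M.center T) h)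
    (v : SigmaT M k T) : v.potential ∈ vecPolySpace k ∧
      ∀ q ∈ polySpace ((k : ℤ) + 1), intElem T q = 0 → ∀ w ∈ crolySpace k (M.center T),
        intElem T (dot v.potential (vrot q + w)) = intElem T (v.rotor * q) + v.boundary q
          + intElem T (dot (v.vRc : VecPoly) w) := by
  let Q : Submodule ℝ Poly := polySpace ((k : ℤ) + 1) ⊓ (intElemₗ H.isBounded).ker
  let W : Submodule ℝ VecPoly := crolySpace k (M.center T)
  have hW : W ≤ vecPolySpace k := by
    rintro _ ⟨r, hr, rfl⟩
    exact koszul_mem_vecPolySpace _ hr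
  let Φ : Q × W →ₗ[ℝ] vecPolySpace k := LinearMap.coprod
    ((vrot ∘ₗ Q.subtype).codRestrict _ fun q => vrot_mem_vecPolySpace q.2.1)
    (W.subtype.codRestrict _ fun w => hW w.2)
  have hinj : Function.Injective Φ := by
    rw [injective_iff_map_eq_zero]
    rintro ⟨⟨q, hq, hq0⟩, ⟨w, hw⟩⟩ hz
    have hz' : vrot q + w = 0 := congrArg Subtype.val hz
    have hqC : ∃ c, q = MvPolynomial.C c := by
      obtain ⟨r, _, rfl⟩ := hw
      exact ⟨_, vrot_eq_zero_of_vrot_add_koszul hz'⟩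
    obtain ⟨c, rfl⟩ := hqC
    have hc : c * intElem T 1 = 0 := by
      rw [← intElem_C_mul H.isBounded, mul_one]; exact hq0
    have hc0 : c = 0 := (mul_eq_zero.1 hc).resolve_right (H.intElem_one_pos hρ).ne'
    rw [vrot_C, zero_add] at hz'
    subst hz' hc0
    simp
  have hsurj : Function.Surjective Φ := by
    intro z
    obtain ⟨C, _, hC⟩ := exists_stable_decomposition hρ k
    obtain ⟨q, hq, w, hw, hq0, hz, _⟩ := hC T _ h H z z.2
    exact ⟨(⟨q, hq, hq0⟩, ⟨w, hw⟩), Subtype.ext hz⟩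
  let e := LinearEquiv.ofBijective Φ ⟨hinj, hsurj⟩
  let ℓ : Q × W →ₗ[ℝ] ℝ := LinearMap.coprod
    ((elemForm H.isBounded v.rotor + v.boundary) ∘ₗ Q.subtype)
    (vecForm H.isBounded (v.vRc : VecPoly) ∘ₗ W.subtype)
  obtain ⟨g, hg, hgr⟩ := exists_represent (vecForm H.isBounded) (vecPolySpace k)
    (fun p _ hp => eq_zero_of_intElem_dot_self H.isBounded (mul_pos hρ H.pos) H.ball_subset hp)
    (ℓ ∘ₗ e.symm.toLinearMap)
  simp only [boundary_apply]
  refine Classical.epsilon_spec (p := fun P => P ∈ vecPolySpace k ∧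
    ∀ q ∈ polySpace ((k : ℤ) + 1), intElem T q = 0 → ∀ w ∈ crolySpace k (M.center T),
      intElem T (dot P (vrot q + w)) = intElem T (v.rotor * q)
        + ∑ E : M.edgesOf T, orientation T E.1 * intEdge E.1 ((v.vE E : ℝ[X]) * traceEdge E.1 q)
        + intElem T (dot (v.vRc : VecPoly) w)) ⟨g, hg, fun q hq hq0 w hw => ?_⟩
  rw [← boundary_apply]
  have h1 := hgr (e (⟨q, hq, hq0⟩, ⟨w, hw⟩))
  rw [LinearMap.comp_apply, LinearEquiv.coe_coe, e.symm_apply_apply] at h1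
  exact h1

/-! ### Bounds on the local reconstructions -/

theorem tnormRotSq_nonneg (v : SigmaT M k T) : 0 ≤ v.tnormRotSq := by
  have h1 := intElem_dot_self_nonneg T (v.vR : VecPoly)
  have h2 := intElem_dot_self_nonneg T (v.vRc : VecPoly)
  have h3 := mul_nonneg (Metric.diam_nonneg (s := T))
    (Finset.sum_nonneg (s := Finset.univ) fun (E : M.edgesOf T) _ =>
      intEdge_sq_nonneg E.1 (v.vE E : ℝ[X]))
  unfold tnormRotSq
  positivity

/-- Cauchy–Schwarz is applied over the edges, at the price of their number, and on each edge. The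
factor h goes to the trace of q, where the discrete trace inequality supplies S. -/
theorem boundary_sq_le (v : SigmaT M k T) {q : Poly} {h N S : ℝ} (hh : 0 < h)
    (hN : (M.edgesOf T).card ≤ N)
    (hS : ∀ E : M.edgesOf T, h * intEdge E.1 (traceEdge E.1 q ^ 2) ≤ S) :
    h * v.boundary q ^ 2 ≤ N * S * ∑ E : M.edgesOf T, intEdge E.1 ((v.vE E : ℝ[X]) ^ 2) := by
  have hsum0 : 0 ≤ ∑ E : M.edgesOf T, h * (orientation T E.1 *
      intEdge E.1 ((v.vE E : ℝ[X]) * traceEdge E.1 q)) ^ 2 :=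
    Finset.sum_nonneg fun E _ => by positivity
  have h1 := sq_sum_le_card_mul_sum_sq (s := (Finset.univ : Finset (M.edgesOf T)))
    (f := fun E => orientation T E.1 * intEdge E.1 ((v.vE E : ℝ[X]) * traceEdge E.1 q))
  rw [Finset.card_univ, Fintype.card_coe] at h1
  calc h * v.boundary q ^ 2
      ≤ h * ((M.edgesOf T).card * ∑ E : M.edgesOf T, (orientation T E.1 *
          intEdge E.1 ((v.vE E : ℝ[X]) * traceEdge E.1 q)) ^ 2) := by
        rw [boundary_apply]; gcongr
    _ = (M.edgesOf T).card * ∑ E : M.edgesOf T, h * (orientation T E.1 *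
          intEdge E.1 ((v.vE E : ℝ[X]) * traceEdge E.1 q)) ^ 2 := by
        rw [← Finset.mul_sum]; ring
    _ ≤ N * ∑ E : M.edgesOf T, S * intEdge E.1 ((v.vE E : ℝ[X]) ^ 2) := by
        refine mul_le_mul hN (Finset.sum_le_sum fun E _ => ?_) hsum0
          ((Nat.cast_nonneg _).trans hN)
        rw [mul_pow, orientation_sq, one_mul]
        have h2 := intEdge_mul_sq_le E.1 (v.vE E : ℝ[X]) (traceEdge E.1 q)
        have h3 := intEdge_sq_nonneg E.1 (v.vE E : ℝ[X])
        calc _ ≤ h * (intEdge E.1 ((v.vE E : ℝ[X]) ^ 2) * intEdge E.1 (traceEdge E.1 q ^ 2)) := by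
              gcongr
          _ = (h * intEdge E.1 (traceEdge E.1 q ^ 2)) * intEdge E.1 ((v.vE E : ℝ[X]) ^ 2) := by ring
          _ ≤ _ := by gcongr; exact hS E
    _ = _ := by rw [← Finset.mul_sum]; ring

theorem edge_isIn (H : ComparableToDisk ρ T (M.center T) (Metric.diam T)) (E : M.edgesOf T) :
    E.1.IsIn (M.center T) (Metric.diam T) :=
  H.edge_isIn (PolygonalMesh.edge_subset_frontier E.2)

/-- Absorption of one factor when the test function is the unknown itself. -/
theorem le_of_mul_self_le {x y : ℝ} (hy : 0 ≤ y) (h : x * x ≤ y * x) : x ≤ y := by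
  nlinarith

/-- The reconstructions are bounded by the component norm. -/
theorem exists_reconstruction_le (hρ : 0 < ρ) (k : ℕ) : ∃ C : ℝ, 0 < C ∧
    ∀ (Ω : Set Plane) (M : PolygonalMesh Ω), M.IsRegular ρ → ∀ T ∈ M.elements,
      ∀ v : SigmaT M k T,
        Metric.diam T ^ 2 * intElem T (v.rotor * v.rotor) ≤ C * v.tnormRotSq ∧
        intElem T (dot v.potential v.potential) ≤ C * v.tnormRotSq := by
  obtain ⟨Ci, hCi, hinv⟩ := exists_intElem_vrot_le hρ (k : ℤ)
  obtain ⟨Ct, hCt, htr⟩ := exists_intEdge_trace_le hρ ((k : ℤ) + 1)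
  obtain ⟨Cd, hCd, hdec⟩ := exists_stable_decomposition hρ k
  set N : ℝ := 3 * (ρ ^ 4)⁻¹ with hN
  have hN0 : 0 < N := by positivity
  set K : ℝ := 2 * Ci + 2 * (N * Ct) with hK
  have hK0 : 0 < K := by positivity
  refine ⟨K + 3 * Cd * (K + N * Ct + 1), by positivity, fun Ω M hM T hT v => ?_⟩
  have H := hM.comparableToDisk hρ hT
  have hcard := hM.card_edgesOf_mul_le hρ hT
  have hh := H.pos
  obtain ⟨hR, hRq⟩ := v.rotor_spec hρ H
  obtain ⟨hP, hPq⟩ := v.potential_spec hρ H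
  have hX0 := v.tnormRotSq_nonneg
  have hX : v.tnormRotSq = intElem T (dot (v.vR : VecPoly) v.vR)
      + intElem T (dot (v.vRc : VecPoly) v.vRc)
      + Metric.diam T * ∑ E : M.edgesOf T, intEdge E.1 ((v.vE E : ℝ[X]) ^ 2) := rfl
  have ha := intElem_dot_self_nonneg T (v.vR : VecPoly)
  have hb := intElem_dot_self_nonneg T (v.vRc : VecPoly)
  have he : 0 ≤ ∑ E : M.edgesOf T, intEdge E.1 ((v.vE E : ℝ[X]) ^ 2) :=
    Finset.sum_nonneg fun E _ => intEdge_sq_nonneg E.1 _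
  have hn := intElem_mul_self_nonneg T v.rotor
  have hp := intElem_dot_self_nonneg T v.potential
  have hbd : ∀ q ∈ polySpace ((k : ℤ) + 1), Metric.diam T * v.boundary q ^ 2
      ≤ N * (Ct * intElem T (q * q)) * ∑ E : M.edgesOf T, intEdge E.1 ((v.vE E : ℝ[X]) ^ 2) :=
    fun q hq => v.boundary_sq_le hh hcard fun E =>
      (htr T _ _ H E.1 (edge_isIn H E)).1 q hq
  set h := Metric.diam T
  set X := v.tnormRotSq
  set a := intElem T (dot (v.vR : VecPoly) v.vR)
  set b := intElem T (dot (v.vRc : VecPoly) v.vRc)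
  set e := ∑ E : M.edgesOf T, intEdge E.1 ((v.vE E : ℝ[X]) ^ 2)
  set n := intElem T (v.rotor * v.rotor)
  set p := intElem T (dot v.potential v.potential)
  have hhe : 0 ≤ h * e := by positivity
  have hrotor : h ^ 2 * n ≤ K * X := by
    have e1 := hRq _ hR
    have e2 := intElem_dot_sq_le H.isBounded (v.vR : VecPoly) (vrot v.rotor)
    have e3 := hinv T _ h H _ hR
    have e4 := hbd _ (polySpace_mono (by omega) hR)
    have e5 : n ^ 2 ≤ 2 * intElem T (dot (v.vR : VecPoly) (vrot v.rotor)) ^ 2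
        + 2 * v.boundary v.rotor ^ 2 := by
      rw [show n = _ from e1]
      nlinarith [sq_nonneg (intElem T (dot (v.vR : VecPoly) (vrot v.rotor))
        + v.boundary v.rotor)]
    -- The quantity absorbed is h²‖R‖². One h² goes to the inverse inequality for rot R; in the
    -- boundary part one h goes to the trace of R and the other to the weight of `vE` in X.
    refine le_of_mul_self_le (by positivity) ?_
    calc h ^ 2 * n * (h ^ 2 * n) = h ^ 2 * (h ^ 2 * n ^ 2) := by ring
      _ ≤ h ^ 2 * (h ^ 2 * (2 * (a * intElem T (dot (vrot v.rotor) (vrot v.rotor)))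
            + 2 * v.boundary v.rotor ^ 2)) := by
          gcongr; exact e5.trans (by gcongr)
      _ = h ^ 2 * (2 * a * (h ^ 2 * intElem T (dot (vrot v.rotor) (vrot v.rotor)))
            + 2 * h * (h * v.boundary v.rotor ^ 2)) := by ring
      _ ≤ h ^ 2 * (2 * a * (Ci * n) + 2 * h * (N * (Ct * n) * e)) := by gcongr
      _ = (2 * Ci * a + 2 * (N * Ct) * (h * e)) * (h ^ 2 * n) := by ring
      _ ≤ (2 * Ci * X + 2 * (N * Ct) * X) * (h ^ 2 * n) := by gcongr <;> linarith
      _ = K * X * (h ^ 2 * n) := by rw [hK]; ring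
  refine ⟨hrotor.trans (by gcongr; exact le_add_of_nonneg_right (by positivity)), ?_⟩
  -- P is tested against its own decomposition; ‖q‖ ≲ h‖P‖ matches the scaling of the bound on hR.
  obtain ⟨q, hq, w, hw, hq0, hz, hqle, hwle⟩ := hdec T _ h H _ hP
  have e1 := hPq q hq hq0 w hw
  rw [hz] at e1
  have e2 := intElem_mul_sq_le H.isBounded v.rotor q
  have e3 := intElem_dot_sq_le H.isBounded (v.vRc : VecPoly) w
  have e4 := hbd q hq
  have e4' : v.boundary q ^ 2 ≤ N * Ct * Cd * (h * e) * p := by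
    refine le_of_mul_le_mul_left ?_ hh
    calc h * v.boundary q ^ 2 ≤ N * (Ct * intElem T (q * q)) * e := e4
      _ ≤ N * (Ct * (Cd * (h ^ 2 * p))) * e := by gcongr
      _ = _ := by ring
  have e5 : p ^ 2 ≤ 3 * intElem T (v.rotor * q) ^ 2 + 3 * v.boundary q ^ 2
      + 3 * intElem T (dot (v.vRc : VecPoly) w) ^ 2 := by
    rw [show p = _ from e1]
    nlinarith [sq_nonneg (intElem T (v.rotor * q) - v.boundary q),
      sq_nonneg (intElem T (v.rotor * q) - intElem T (dot (v.vRc : VecPoly) w)),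
      sq_nonneg (v.boundary q - intElem T (dot (v.vRc : VecPoly) w))]
  have hpot : p ≤ 3 * Cd * (K + N * Ct + 1) * X := by
    refine le_of_mul_self_le (by positivity) ?_
    calc p * p = p ^ 2 := by ring
      _ ≤ 3 * (n * (Cd * (h ^ 2 * p))) + 3 * (N * Ct * Cd * (h * e) * p)
          + 3 * (b * (Cd * p)) := by
          refine e5.trans ?_
          gcongr
          · exact e2.trans (by gcongr)
          · exact e3.trans (by gcongr)
      _ = 3 * Cd * (h ^ 2 * n + N * Ct * (h * e) + 1 * b) * p := by ring
      _ ≤ 3 * Cd * (K * X + N * Ct * X + 1 * X) * p := by gcongr <;> linarith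
      _ = _ := by ring
  exact hpot.trans (by gcongr; exact le_add_of_nonneg_left hK0.le)

/-- The element components are projections of the potential. -/
theorem intElem_components_le (hρ : 0 < ρ) {h : ℝ} (H : ComparableToDisk ρ T (M.center T) h)
    (v : SigmaT M k T) :
    intElem T (dot (v.vR : VecPoly) v.vR) ≤ intElem T (dot v.potential v.potential) ∧
    intElem T (dot (v.vRc : VecPoly) v.vRc) ≤ intElem T (dot v.potential v.potential) := by
  obtain ⟨_, hRq⟩ := v.rotor_spec hρ H
  obtain ⟨_, hPq⟩ := v.potential_spec hρ H
  have key : ∀ w : VecPoly, intElem T (dot v.potential w) = intElem T (dot w w) →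
      intElem T (dot w w) ≤ intElem T (dot v.potential v.potential) := fun w hw => by
    have h1 := intElem_dot_sq_le H.isBounded v.potential w
    rw [hw] at h1
    have h2 := intElem_dot_self_nonneg T w
    have h3 := intElem_dot_self_nonneg T v.potential
    nlinarith
  constructor
  · apply key
    obtain ⟨q, hq, hqR⟩ := v.vR.2
    rw [show (k : ℤ) - 1 + 1 = k by ring] at hq
    -- Since v_R is the rotor of some q in P^k, the mean-free version of q is an admissible test
    -- function both for P and for R; combining the two identities cancels the boundary terms.
    obtain ⟨c, hc0, _⟩ := H.exists_sub_mean hρ q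
    have hq' : q - MvPolynomial.C c ∈ polySpace k :=
      Submodule.sub_mem _ hq (C_mem_polySpace (by positivity) c)
    have hrot : vrot (q - MvPolynomial.C c) = v.vR := by rw [map_sub, vrot_C, sub_zero, hqR]
    have h1 := hPq _ (polySpace_mono (by omega) hq') hc0 0 (Submodule.zero_mem _)
    have h2 := hRq _ hq'
    have h0 : intElem T (dot (v.vRc : VecPoly) 0) = 0 :=
      (vecForm H.isBounded (v.vRc : VecPoly)).map_zero
    rw [add_zero, hrot, h0, add_zero] at h1
    rw [hrot] at h2
    linarith
  · apply key
    have h1 := hPq 0 (Submodule.zero_mem _) (intElemₗ H.isBounded).map_zero _ v.vRc.2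
    have h0 : intElem T (v.rotor * 0) = 0 := (elemForm H.isBounded v.rotor).map_zero
    rw [map_zero, zero_add, h0, map_zero, add_zero, zero_add] at h1
    exact h1

/-! ### Assembly of the local norm equivalence -/

theorem sum_edges_le {N S h : ℝ} (hN : (M.edgesOf T).card ≤ N) (hS0 : 0 ≤ S)
    {f : M.edgesOf T → ℝ} (hS : ∀ E, h * f E ≤ S) : h * ∑ E, f E ≤ N * S := by
  rw [Finset.mul_sum]
  calc ∑ E : M.edgesOf T, h * f E ≤ ∑ _E : M.edgesOf T, S := Finset.sum_le_sum fun E _ => hS E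
    _ = (M.edgesOf T).card * S := by simp
    _ ≤ N * S := by gcongr

theorem mem_closedBall_of_mem_verticesOf {x₀ : Plane} {h : ℝ} (H : ComparableToDisk ρ T x₀ h)
    {x : Plane} (hx : x ∈ M.verticesOf T) : x ∈ Metric.closedBall x₀ h := by
  classical
  obtain ⟨E, hE, hxE⟩ := Finset.mem_biUnion.1 hx
  have h1 := H.edge_isIn (PolygonalMesh.edge_subset_frontier hE)
  rcases Finset.mem_insert.1 hxE with rfl | h2
  · exact h1.1
  · rw [Finset.mem_singleton.1 h2]; exact h1.2

/-- The real-number bookkeeping, all powers of h being included in the variables: p and n stand for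
P and R; TP, TR, VR for their edge traces and vertex values; D, G, W for the stabilisation terms;
VE, CE, CV for the edge and vertex components. From the product norm one bounds X first, then n
through X, then CE and CV. In the other direction X bounds p and n, which bound D, G, W. The
constant is the sum of those of the two directions. -/
theorem le_and_le_of_component_bounds
    {X a b p n VE D G W CE CV TP TR VR Cr c c' : ℝ} (hX : X = a + b + VE) (ha : 0 ≤ a) (hb : 0 ≤ b)
    (haP : a ≤ p) (hbP : b ≤ p) (hR : n ≤ Cr * X) (hP : p ≤ Cr * X) (hCr : 0 < Cr)
    (hc : 0 ≤ c) (hc' : 0 ≤ c') (hX0 : 0 ≤ X) (hp : 0 ≤ p)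
    (pD : 0 ≤ D) (pG : 0 ≤ G) (pW : 0 ≤ W) (pCE : 0 ≤ CE) (pCV : 0 ≤ CV)
    (hTP : TP ≤ c * p) (hTR : TR ≤ c * n) (hVR : VR ≤ 2 * c' * n)
    (t1 : D ≤ 2 * TP + 2 * VE) (t2 : VE ≤ 2 * TP + 2 * D)
    (c1 : G ≤ 2 * TR + 2 * CE) (c2 : CE ≤ 2 * TR + 2 * G)
    (v1 : W ≤ 2 * VR + 2 * CV) (v2 : CV ≤ 2 * VR + 2 * W) :
    X + CE + CV ≤ ((4 + 2 * c) + (2 * c + 4 * c') * (Cr * (4 + 2 * c)) +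
      ((4 + 2 * c) * Cr + (2 * c + 4 * c') * Cr + 2)) * (p + D + G + W) ∧
    p + D + G + W ≤ ((4 + 2 * c) + (2 * c + 4 * c') * (Cr * (4 + 2 * c)) +
      ((4 + 2 * c) * Cr + (2 * c + 4 * c') * Cr + 2)) * (X + CE + CV) := by
  set A : ℝ := 4 + 2 * c with hA
  set B : ℝ := 2 * c + 4 * c' with hB
  have hA0 : 0 ≤ A := by positivity
  have hB0 : 0 ≤ B := by positivity
  set L := p + D + G + W with hL
  set Y := X + CE + CV with hY
  have hL0 : 0 ≤ L := by positivity
  have hY0 : 0 ≤ Y := by positivity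
  constructor
  · have hpL : c * p ≤ c * L := mul_le_mul_of_nonneg_left (by linarith) hc
    have x1 : X ≤ A * L := by rw [hX, hA]; linarith
    have x2 : n ≤ Cr * (A * L) := hR.trans (mul_le_mul_of_nonneg_left x1 hCr.le)
    have x3 : Y ≤ X + B * n + 2 * L := by rw [hY, hB]; linarith
    calc Y ≤ A * L + B * (Cr * (A * L)) + 2 * L := x3.trans (by gcongr)
      _ = (A + B * (Cr * A) + 2) * L := by ring
      _ ≤ _ := by
        refine mul_le_mul_of_nonneg_right ?_ hL0
        have : 0 ≤ A * Cr + B * Cr := by positivity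
        linarith
  · have hXY : X ≤ Y := by linarith
    have y2 : p ≤ Cr * Y := hP.trans (mul_le_mul_of_nonneg_left hXY hCr.le)
    have y3 : n ≤ Cr * Y := hR.trans (mul_le_mul_of_nonneg_left hXY hCr.le)
    have y4 : L ≤ A * p + B * n + 2 * Y := by
      rw [hL, hA, hB]; linarith
    calc L ≤ A * (Cr * Y) + B * (Cr * Y) + 2 * Y := y4.trans (by gcongr)
      _ = (A * Cr + B * Cr + 2) * Y := by ring
      _ ≤ _ := by
        refine mul_le_mul_of_nonneg_right ?_ hY0
        have : 0 ≤ A + B * (Cr * A) := by positivity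
        linarith

/-- Local norm equivalence, for the squares of the norms. -/
theorem exists_norm_equiv (hρ : 0 < ρ) (k : ℕ) : ∃ C : ℝ, 0 < C ∧
    ∀ (Ω : Set Plane) (M : PolygonalMesh Ω), M.IsRegular ρ → ∀ T ∈ M.elements,
      ∀ v : SigmaT M k T, v.tnormSq ≤ C * l2prod v v ∧ l2prod v v ≤ C * v.tnormSq := by
  obtain ⟨Cr, hCr, hrec⟩ := exists_reconstruction_le hρ k
  obtain ⟨Ct, hCt, htr⟩ := exists_intEdge_trace_le hρ (k : ℤ)
  obtain ⟨Cp, hCp, hpt⟩ := exists_evalAt_sq_le_intElem hρ (k : ℤ)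
  set N : ℝ := 3 * (ρ ^ 4)⁻¹ with hN
  have hN0 : 0 < N := by positivity
  set A : ℝ := 4 + 2 * (N * Ct) with hA
  set B : ℝ := 2 * (N * Ct) + 4 * (N * Cp) with hB
  refine ⟨A + B * (Cr * A) + (A * Cr + B * Cr + 2), by positivity, fun Ω M hM T hT v => ?_⟩
  have H := hM.comparableToDisk hρ hT
  have hcard := hM.card_edgesOf_mul_le hρ hT
  have hh := H.pos
  have hcardV : ((M.verticesOf T).card : ℝ) ≤ N * 2 :=
    le_trans (by exact_mod_cast M.card_verticesOf_le T) (mul_le_mul_of_nonneg_right hcard two_pos.le)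
  obtain ⟨hR, -⟩ := v.rotor_spec hρ H
  obtain ⟨hP, -⟩ := v.potential_spec hρ H
  obtain ⟨hRle, hPle⟩ := hrec Ω M hM T hT v
  obtain ⟨haP, hbP⟩ := v.intElem_components_le hρ H
  have hX0 := v.tnormRotSq_nonneg
  have hn := intElem_mul_self_nonneg T v.rotor
  have hp := intElem_dot_self_nonneg T v.potential
  have htan := sum_edges_le (h := Metric.diam T) hcard (by positivity) fun E : M.edgesOf T =>
    (htr T _ _ H E.1 (edge_isIn H E)).2 _ hP
  have htrR := sum_edges_le (h := Metric.diam T) hcard (by positivity) fun E : M.edgesOf T =>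
    (htr T _ _ H E.1 (edge_isIn H E)).1 _ hR
  have hvert : Metric.diam T ^ 2 * ∑ x : M.verticesOf T, evalAt x.1 v.rotor ^ 2
      ≤ N * 2 * (Cp * intElem T (v.rotor * v.rotor)) := by
    rw [Finset.mul_sum]
    calc _ ≤ ∑ _x : M.verticesOf T, Cp * intElem T (v.rotor * v.rotor) :=
          Finset.sum_le_sum fun x _ => (hpt T _ _ H _ hR).1 _
            (mem_closedBall_of_mem_verticesOf H x.2)
      _ = (M.verticesOf T).card * (Cp * intElem T (v.rotor * v.rotor)) := by simp
      _ ≤ _ := by gcongr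
  have hX : v.tnormRotSq = intElem T (dot (v.vR : VecPoly) v.vR)
      + intElem T (dot (v.vRc : VecPoly) v.vRc)
      + Metric.diam T * ∑ E : M.edgesOf T, intEdge E.1 ((v.vE E : ℝ[X]) ^ 2) := rfl
  have hY : v.tnormSq = v.tnormRotSq
      + Metric.diam T ^ 3 * ∑ E : M.edgesOf T, intEdge E.1 ((v.cE E : ℝ[X]) ^ 2)
      + Metric.diam T ^ 4 * ∑ x : M.verticesOf T, v.cV x ^ 2 := by
    simp only [tnormSq, sq_abs]
  have hL : l2prod v v = intElem T (dot v.potential v.potential)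
      + Metric.diam T * ∑ E : M.edgesOf T,
          intEdge E.1 ((tangentialTrace E.1 v.potential - v.vE E) ^ 2)
      + Metric.diam T ^ 3 * ∑ E : M.edgesOf T,
          intEdge E.1 (edgeProj E.1 ((k : ℤ) - 1) (traceEdge E.1 v.rotor - v.cE E) ^ 2)
      + Metric.diam T ^ 4 * ∑ x : M.verticesOf T, (evalAt x.1 v.rotor - v.cV x) ^ 2 := by
    simp only [l2prod, sq]
  have nonneg : ∀ f : M.edgesOf T → ℝ[X], 0 ≤ ∑ E : M.edgesOf T, intEdge E.1 (f E ^ 2) :=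
    fun f => Finset.sum_nonneg fun E _ => intEdge_sq_nonneg E.1 _
  have nonnegV : ∀ f : M.verticesOf T → ℝ, 0 ≤ ∑ x, f x ^ 2 :=
    fun f => Finset.sum_nonneg fun x _ => sq_nonneg _
  have sum2 : ∀ f g l : M.edgesOf T → ℝ[X],
      (∀ E, intEdge E.1 (f E ^ 2) ≤ 2 * intEdge E.1 (g E ^ 2) + 2 * intEdge E.1 (l E ^ 2)) →
      ∑ E : M.edgesOf T, intEdge E.1 (f E ^ 2) ≤ 2 * ∑ E : M.edgesOf T, intEdge E.1 (g E ^ 2)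
        + 2 * ∑ E : M.edgesOf T, intEdge E.1 (l E ^ 2) := fun f g l hfgl => by
    rw [Finset.mul_sum, Finset.mul_sum, ← Finset.sum_add_distrib]
    exact Finset.sum_le_sum fun E _ => hfgl E
  have sub_sq : ∀ (E : Edge) (f g : ℝ[X]), intEdge E ((f - g) ^ 2)
      ≤ 2 * intEdge E (f ^ 2) + 2 * intEdge E (g ^ 2) := fun E f g => by
    have := intEdge_add_sq_le E f (-g)
    rwa [neg_sq, ← sub_eq_add_neg] at this
  have t1 := sum2 (fun E => tangentialTrace E.1 v.potential - v.vE E)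
    (fun E => tangentialTrace E.1 v.potential) (fun E => v.vE E) fun E => sub_sq E.1 _ _
  have t2 := sum2 (fun E => (v.vE E : ℝ[X])) (fun E => tangentialTrace E.1 v.potential)
    (fun E => tangentialTrace E.1 v.potential - v.vE E) fun E => by
      simpa using sub_sq E.1 (tangentialTrace E.1 v.potential)
        (tangentialTrace E.1 v.potential - v.vE E)
  have c1 := sum2 (fun E => edgeProj E.1 ((k : ℤ) - 1) (traceEdge E.1 v.rotor - v.cE E))
    (fun E => traceEdge E.1 v.rotor) (fun E => v.cE E) fun E =>
      (intEdge_edgeProj_sq_le _ _ _).trans (sub_sq E.1 _ _)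
  have c2 := sum2 (fun E => (v.cE E : ℝ[X])) (fun E => traceEdge E.1 v.rotor)
    (fun E => edgeProj E.1 ((k : ℤ) - 1) (traceEdge E.1 v.rotor - v.cE E)) fun E =>
      intEdge_sq_le_of_edgeProj_sub _ (v.cE E).2
  have v1 : ∑ x : M.verticesOf T, (evalAt x.1 v.rotor - v.cV x) ^ 2
      ≤ 2 * ∑ x : M.verticesOf T, evalAt x.1 v.rotor ^ 2 + 2 * ∑ x : M.verticesOf T, v.cV x ^ 2 := by
    rw [Finset.mul_sum, Finset.mul_sum, ← Finset.sum_add_distrib]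
    exact Finset.sum_le_sum fun x _ => by nlinarith [sq_nonneg (evalAt x.1 v.rotor + v.cV x)]
  have v2 : ∑ x : M.verticesOf T, v.cV x ^ 2 ≤ 2 * ∑ x : M.verticesOf T, evalAt x.1 v.rotor ^ 2
      + 2 * ∑ x : M.verticesOf T, (evalAt x.1 v.rotor - v.cV x) ^ 2 := by
    rw [Finset.mul_sum, Finset.mul_sum, ← Finset.sum_add_distrib]
    exact Finset.sum_le_sum fun x _ => by
      nlinarith [sq_nonneg (evalAt x.1 v.rotor + (evalAt x.1 v.rotor - v.cV x))]
  have sD := nonneg fun E => tangentialTrace E.1 v.potential - v.vE E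
  have sC := nonneg fun E => (v.cE E : ℝ[X])
  have sG := nonneg fun E => edgeProj E.1 ((k : ℤ) - 1) (traceEdge E.1 v.rotor - v.cE E)
  have sV := nonnegV fun x => v.cV x
  have sW := nonnegV fun x => evalAt x.1 v.rotor - v.cV x
  rw [hL, hY]
  set h := Metric.diam T
  set X := v.tnormRotSq
  set a := intElem T (dot (v.vR : VecPoly) v.vR)
  set b := intElem T (dot (v.vRc : VecPoly) v.vRc)
  set n := intElem T (v.rotor * v.rotor)
  set p := intElem T (dot v.potential v.potential)
  generalize (∑ E : M.edgesOf T, intEdge E.1 (tangentialTrace E.1 v.potential ^ 2)) = TP at *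
  generalize (∑ E : M.edgesOf T, intEdge E.1 ((v.vE E : ℝ[X]) ^ 2)) = VE at *
  generalize (∑ E : M.edgesOf T,
    intEdge E.1 ((tangentialTrace E.1 v.potential - v.vE E) ^ 2)) = D at *
  generalize (∑ E : M.edgesOf T, intEdge E.1 (traceEdge E.1 v.rotor ^ 2)) = TR at *
  generalize (∑ E : M.edgesOf T, intEdge E.1 ((v.cE E : ℝ[X]) ^ 2)) = CE at *
  generalize (∑ E : M.edgesOf T,
    intEdge E.1 (edgeProj E.1 ((k : ℤ) - 1) (traceEdge E.1 v.rotor - v.cE E) ^ 2)) = G at *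
  generalize (∑ x : M.verticesOf T, evalAt x.1 v.rotor ^ 2) = VR at *
  generalize (∑ x : M.verticesOf T, v.cV x ^ 2) = CV at *
  generalize (∑ x : M.verticesOf T, (evalAt x.1 v.rotor - v.cV x) ^ 2) = W at *
  -- The weights h³ and h⁴ exceed those of the trace and point-value bounds by exactly h², turning
  -- ‖R‖² into the quantity h²‖R‖² controlled by X.
  have hTR : h ^ 3 * TR ≤ N * Ct * (h ^ 2 * n) := by
    calc h ^ 3 * TR = h ^ 2 * (h * TR) := by ring
      _ ≤ h ^ 2 * (N * (Ct * n)) := by gcongr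
      _ = _ := by ring
  have hVR : h ^ 4 * VR ≤ 2 * (N * Cp) * (h ^ 2 * n) := by
    calc h ^ 4 * VR = h ^ 2 * (h ^ 2 * VR) := by ring
      _ ≤ h ^ 2 * (N * 2 * (Cp * n)) := by gcongr
      _ = _ := by ring
  have hTP : h * TP ≤ N * Ct * p := by linarith
  have t1' : h * D ≤ 2 * (h * TP) + 2 * (h * VE) := by
    calc h * D ≤ h * (2 * TP + 2 * VE) := by gcongr
      _ = _ := by ring
  have t2' : h * VE ≤ 2 * (h * TP) + 2 * (h * D) := by
    calc h * VE ≤ h * (2 * TP + 2 * D) := by gcongr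
      _ = _ := by ring
  have c1' : h ^ 3 * G ≤ 2 * (h ^ 3 * TR) + 2 * (h ^ 3 * CE) := by
    calc h ^ 3 * G ≤ h ^ 3 * (2 * TR + 2 * CE) := by gcongr
      _ = _ := by ring
  have c2' : h ^ 3 * CE ≤ 2 * (h ^ 3 * TR) + 2 * (h ^ 3 * G) := by
    calc h ^ 3 * CE ≤ h ^ 3 * (2 * TR + 2 * G) := by gcongr
      _ = _ := by ring
  have v1' : h ^ 4 * W ≤ 2 * (h ^ 4 * VR) + 2 * (h ^ 4 * CV) := by
    calc h ^ 4 * W ≤ h ^ 4 * (2 * VR + 2 * CV) := by gcongr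
      _ = _ := by ring
  have v2' : h ^ 4 * CV ≤ 2 * (h ^ 4 * VR) + 2 * (h ^ 4 * W) := by
    calc h ^ 4 * CV ≤ h ^ 4 * (2 * VR + 2 * W) := by gcongr
      _ = _ := by ring
  have pD : 0 ≤ h * D := by positivity
  have pG : 0 ≤ h ^ 3 * G := by positivity
  have pW : 0 ≤ h ^ 4 * W := by positivity
  have pCE : 0 ≤ h ^ 3 * CE := by positivity
  have pCV : 0 ≤ h ^ 4 * CV := by positivity
  exact le_and_le_of_component_bounds hX (intElem_dot_self_nonneg T _)
    (intElem_dot_self_nonneg T _) haP hbP hRle hPle hCr (by positivity) (by positivity) hX0 hp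
    pD pG pW pCE pCV hTP hTR hVR t1' t2' c1' c2' v1' v2'

theorem tnormSq_nonneg (v : SigmaT M k T) : 0 ≤ v.tnormSq := by
  have h1 := v.tnormRotSq_nonneg
  have h2 := Finset.sum_nonneg (s := Finset.univ) fun (E : M.edgesOf T) _ =>
    intEdge_sq_nonneg E.1 (v.cE E : ℝ[X])
  have h3 := Metric.diam_nonneg (s := T)
  unfold tnormSq
  positivity

end SigmaT

end RotRot

/-! ### From squares to norms and from elements to the mesh -/

theorem mainTheorem11 (Ω : Set RotRot.Plane) (hΩ : RotRot.IsPolygonal Ω)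
    (hΩ_contractible : ContractibleSpace Ω) (hΩ_diam : Metric.diam Ω = 1)
    (ρ : ℝ) (hρ : 0 < ρ) (k : ℕ) :
    ∃ C : ℝ, 0 < C ∧ ∀ M : RotRot.PolygonalMesh Ω, M.IsRegular ρ →
      (∀ T ∈ M.elements, ∀ v : RotRot.SigmaT M k T,
        v.tnorm ≤ C * v.opNorm ∧ v.opNorm ≤ C * v.tnorm) ∧
      (∀ v : RotRot.SigmaH M k,
        v.tnorm ≤ C * v.opNorm ∧ v.opNorm ≤ C * v.tnorm) := by
  obtain ⟨C, hC, hle⟩ := RotRot.SigmaT.exists_norm_equiv hρ k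
  -- The estimates so far concern squares, so the constant for the norms is √C, the same for every
  -- element and for the sum.
  have hsqrt : ∀ a b : ℝ, a ≤ C * b → √a ≤ √C * √b := fun a b hab => by
    rw [← Real.sqrt_mul hC.le]
    exact Real.sqrt_le_sqrt hab
  refine ⟨√C, Real.sqrt_pos.2 hC, fun M hM => ⟨fun T hT v => ?_, fun v => ?_⟩⟩
  · obtain ⟨h1, h2⟩ := hle Ω M hM T hT v
    exact ⟨hsqrt _ _ h1, hsqrt _ _ h2⟩
  · have hsum : ∑ T : M.elements, (v.restrict T).tnorm ^ 2
        = ∑ T : M.elements, (v.restrict T).tnormSq :=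
      Finset.sum_congr rfl fun T _ => Real.sq_sqrt (RotRot.SigmaT.tnormSq_nonneg _)
    rw [RotRot.SigmaH.tnorm, RotRot.SigmaH.opNorm, RotRot.SigmaH.l2prod, hsum]
    refine ⟨hsqrt _ _ ?_, hsqrt _ _ ?_⟩
    · rw [Finset.mul_sum]
      exact Finset.sum_le_sum fun T _ => (hle Ω M hM T.1 T.2 (v.restrict T)).1
    · rw [Finset.mul_sum]
      exact Finset.sum_le_sum fun T _ => (hle Ω M hM T.1 T.2 (v.restrict T)).2
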